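/- Let $0<\alpha<1$, $T>0$, let $U\subseteq\mathbb{R}^m$ be open, and let $f:[0,T]\times U\to\mathbb{R}^m$ be continuous and differentiable with respect to its second argument, with Jacobian matrix $f'(t,x)=\frac{\partial f}{\partial x}(t,x)$ continuous on $[0,T]\times U$ (for autonomous $f=f(x)$: $f$ is of class $C^1$ on $U$). Put $$I^{\beta}g(t)=\frac1{\Gamma(\beta)}\int_0^t(t-x)^{\beta-1}g(x)\,\mathrm{d}x ,$$ and for a continuous function $g$ on $[0,T]$ let $g^{(\alpha)}=\frac{\mathrm d}{\mathrm dt}I^{1-\alpha}(g-g(0))$ denote its Caputo derivative (with one-sided derivatives at $0$ and $T$), which for absolutely continuous $g$ is given almost everywhere by the classical formula $$D^{\alpha}g(t)=\frac1{\Gamma(1-\alpha)}\int_0^t(t-x)^{-\alpha}g'(x)\,\mathrm{d}x .$$ Solutions below are continuous functions on $[0,T]$. Let $\rho_0\in\mathbb{R}^m$ be such that the initial value problem $$y^{(\alpha)}(t)=f(t,y(t)),\quad t\in[0,T],\qquad y(0)=\rho,\qquad\qquad(*)$$ has, for $\rho=\rho_0$, a solution on $[0,T]$ with values in $U$. Then,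 for each $\rho$, problem $(*)$ has at most one solution on $[0,T]$ with values in $U$, and it has one for all $\rho$ in a neighbourhood of $\rho_0$; denote it by $y(t,\rho)$. For every $t\in[0,T]$, the map $\rho\mapsto y(t,\rho)$ is differentiable at $\rho_0$, and $$\frac{\partial}{\partial\rho_0}y(t,\rho_0)=\Phi(t,\rho_0),$$ where $\Phi(\cdot,\rho_0):[0,T]\to\mathbb{R}^{m\times m}$ is the unique solution of the fractional variational problem $$\Phi^{(\alpha)}(t,\rho_0)=f'(t,y(t,\rho_0))\,\Phi(t,\rho_0),\quad t\in[0,T],\qquad \Phi(0,\rho_0)=I .$$ For continuous functions on $[0,T]$ this problem is equivalent to the weakly singular Volterra integral equation $$\Phi(t,\rho_0)=I+\frac1{\Gamma(\alpha)}\int_0^t(t-x)^{\alpha-1}f'(x,y(x,\rho_0))\,\Phi(x,\rho_0)\,\mathrm{d}x,\qquad t\in[0,T].$$ If, moreover, $f$ is of class $C^2$ on $[0,T]\times U$, then $\Phi(\cdot,\rho_0)$ is continuously differentiable on $(0,T]$ with integrable derivative, and its variational equation also holds with the classical formula: for every $t\in(0,T]$ the integral defining $D^{\alpha}\Phi(t,\rho_0)$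 converges and $D^{\alpha}\Phi(t,\rho_0)=f'(t,y(t,\rho_0))\,\Phi(t,\rho_0)$. -/

import Mathlib

open Set Filter Topology

/-- The Riemann-Liouville integral `I^β g (t) = 1/Γ(β) ∫₀ᵗ (t - x)^(β-1) g(x) dx`. -/
noncomputable def rlIntegral {X : Type*} [NormedAddCommGroup X] [NormedSpace ℝ X]
    (β : ℝ) (g : ℝ → X) (t : ℝ) : X :=
  (1 / Real.Gamma β) • ∫ x in (0 : ℝ)..t, (t - x) ^ (β - 1) • g x

/-- The Caputo derivative of order `α ∈ (0,1)` by its classical formula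
`D^α g (t) = 1/Γ(1-α) ∫₀ᵗ (t - x)^(-α) g'(x) dx`, for `t > 0` and for functions `g` that are
continuous, differentiable in the interior, and such that the integrand is integrable. -/
noncomputable def caputoDeriv {X : Type*} [NormedAddCommGroup X] [NormedSpace ℝ X]
    (α : ℝ) (g : ℝ → X) (t : ℝ) : X :=
  (1 / Real.Gamma (1 - α)) • ∫ x in (0 : ℝ)..t, (t - x) ^ (-α) • deriv g x

/-- `v` is the value at `t ∈ [0,T]` of the Caputo derivative of order `α ∈ (0,1)` of the
continuous function `g` on `[0,T]`, that is, of the Riemann-Liouville derivative of `g - g(0)`: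
`D^α g = d/dt I^(1-α) (g - g(0))` (one-sided derivative at the end points). This is the usual
definition of the Caputo derivative for functions that need not be absolutely continuous; where
`g` is absolutely continuous it gives the classical formula, because then
`I^(1-α) (g - g(0)) = I^1 I^(1-α) (dg/dx)`. Unlike the classical formula, which is an
integral over an empty interval at `t = 0`, it has the right value at `t = 0` also. -/
def HasCaputoDerivAt {X : Type*} [NormedAddCommGroup X] [NormedSpace ℝ X]
    (α T : ℝ) (g : ℝ → X) (v : X) (t : ℝ) : Prop :=
  HasDerivWithinAt (rlIntegral (1 - α) (fun x => g x - g 0)) v (Icc 0 T) t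

/-- `z` is a (continuous) solution on `[0,T]`, with values in `U`, of the initial value problem
`z^(α)(t) = F(t, z(t))`, `z(0) = ρ`, for the Caputo derivative of order `α`. -/
structure IsCaputoSolution {X : Type*} [NormedAddCommGroup X] [NormedSpace ℝ X]
    (α T : ℝ) (F : ℝ → X → X) (U : Set X) (ρ : X) (z : ℝ → X) : Prop where
  continuousOn : ContinuousOn z (Icc 0 T)
  mem : ∀ t ∈ Icc 0 T, z t ∈ U
  equation : ∀ t ∈ Icc 0 T, HasCaputoDerivAt α T z (F t (z t)) t
  initial : z 0 = ρ

/-- `z` is a (continuous) solution on `[0,T]`, with values in `U`, of the weakly singular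
Volterra integral equation `z(t) = ρ + 1/Γ(α) ∫₀ᵗ (t - x)^(α-1) F(x, z(x)) dx`. -/
structure IsVolterraSolution {X : Type*} [NormedAddCommGroup X] [NormedSpace ℝ X]
    (α T : ℝ) (F : ℝ → X → X) (U : Set X) (ρ : X) (z : ℝ → X) : Prop where
  continuousOn : ContinuousOn z (Icc 0 T)
  mem : ∀ t ∈ Icc 0 T, z t ∈ U
  equation : ∀ t ∈ Icc 0 T, z t = ρ + rlIntegral α (fun x => F x (z x)) t

/-- The right-hand side `(t, Ψ) ↦ f'(t, y(t)) Ψ` of the variational problem along `y`, with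
`f'(t, ·)` the Jacobian of `f(t, ·)`; `m × m` matrices are linear maps of `ℝ^m`. -/
noncomputable def variationalField {E : Type*} [NormedAddCommGroup E] [NormedSpace ℝ E]
    (f : ℝ → E → E) (y : ℝ → E) (t : ℝ) (Ψ : E →L[ℝ] E) : E →L[ℝ] E :=
  (fderiv ℝ (f t) (y t)).comp Ψ

open MeasureTheory ProbabilityTheory

/-! The work is done on the Volterra equation. Fubini and the beta integral give the semigroup law
I^δ I^β = I^(δ+β) (`rlIntegral_rlIntegral`), and with it the Caputo problem and the Volterra
equation follow from each other (`isCaputoSolution_iff_isVolterraSolution`). In a norm weighted by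
exp(kt) t^(γ-1) with k large, I^α composed with a Lipschitz map has constant at most 1/2
(`exists_exp_weight`). This yields global solvability for Lipschitz fields
(`exists_volterra_solution`) and a singular Grönwall inequality (`exists_volterra_gronwall`), hence
stability and uniqueness. The given trajectory is compact in U, so f may be replaced near it by a
globally Lipschitz field (`exists_cutoff`); stability keeps solutions with nearby initial values
where the two fields agree.

For differentiability (`hasFDerivAt_volterra`), the error e = y(·,ρ) - y(·,ρ₀) - Φ(ρ - ρ₀) solves a
linear Volterra equation whose source is I^α of the Taylor remainder of f. That remainder is o(|ρ -
ρ₀|) uniformly in time, and Grönwall passes this on to e.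

For the classical formula, formally differentiating z = ρ + I^α F(·,z) gives a linear Volterra
equation for z' with source t^(α-1) F(0,ρ)/Γ(α). It has a solution v of order t^(α-1), and v is
identified as z' because the Picard iterates and their derivatives converge together
(`exists_eq_integral_of_lipschitz`). This is applied to the pair (y, Φ), whose joint field is C¹
when f is C²; then I^(1-α) v is the Caputo derivative (`IsCaputoSolution.classical`). -/

/-! ### Beta integrals -/

theorem integral_rpow_mul_rpow_eq_beta {a b : ℝ} (ha : 0 < a) (hb : 0 < b) :
    ∫ u in (0 : ℝ)..1, (1 - u) ^ (b - 1) * u ^ (a - 1) = beta a b := by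
  rw [beta_eq_betaIntegralReal a b ha hb, Complex.betaIntegral,
    intervalIntegral.integral_of_le zero_le_one, intervalIntegral.integral_of_le zero_le_one,
    ← RCLike.re_to_complex, ← integral_re]
  · refine setIntegral_congr_fun measurableSet_Ioc fun x ⟨hx1, hx₂⟩ ↦ ?_
    norm_cast
    rw [← Complex.ofReal_cpow, ← Complex.ofReal_cpow, RCLike.re_to_complex,
      Complex.re_mul_ofReal, Complex.ofReal_re, mul_comm]
    all_goals linarith
  convert! Complex.betaIntegral_convergent (u := a) (v := b) (by simpa) (by simpa)
  rw [intervalIntegrable_iff_integrableOn_Ioc_of_le (by simp), IntegrableOn]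

theorem integral_sub_rpow_mul_sub_rpow {a b s t : ℝ} (ha : 0 < a) (hb : 0 < b) (hst : s < t) :
    ∫ x in s..t, (t - x) ^ (b - 1) * (x - s) ^ (a - 1) = beta a b * (t - s) ^ (a + b - 1) := by
  have hc : 0 < t - s := sub_pos.2 hst
  have h := intervalIntegral.integral_comp_add_mul (a := 0) (b := 1)
    (fun x => (t - x) ^ (b - 1) * (x - s) ^ (a - 1)) hc.ne' s
  rw [mul_zero, mul_one, add_zero, add_sub_cancel] at h
  have h2 : ∫ u in (0 : ℝ)..1, (t - (s + (t - s) * u)) ^ (b - 1) * (s + (t - s) * u - s) ^ (a - 1)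
      = (t - s) ^ (a + b - 2) * beta a b := by
    rw [← integral_rpow_mul_rpow_eq_beta ha hb, ← intervalIntegral.integral_const_mul]
    refine intervalIntegral.integral_congr fun u hu => ?_
    rw [uIcc_of_le zero_le_one] at hu
    have e1 : t - (s + (t - s) * u) = (t - s) * (1 - u) := by ring
    have e2 : s + (t - s) * u - s = (t - s) * u := by ring
    simp only [e1, e2]
    rw [Real.mul_rpow hc.le (by linarith [hu.2]), Real.mul_rpow hc.le hu.1,
      show a + b - 2 = (b - 1) + (a - 1) by ring, Real.rpow_add hc]
    ring
  rw [h2, smul_eq_mul, inv_mul_eq_div, eq_div_iff hc.ne'] at h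
  rw [← h, show a + b - 1 = (a + b - 2) + 1 by ring, Real.rpow_add hc, Real.rpow_one]
  ring

/-- A non-integrable function has integral `0` by convention, so the positive beta value already
forces integrability. -/
theorem intervalIntegrable_sub_rpow_mul_sub_rpow {a b s t : ℝ} (ha : 0 < a) (hb : 0 < b)
    (hst : s < t) :
    IntervalIntegrable (fun x => (t - x) ^ (b - 1) * (x - s) ^ (a - 1)) volume s t := by
  refine intervalIntegral.intervalIntegrable_of_integral_ne_zero ?_
  rw [integral_sub_rpow_mul_sub_rpow ha hb hst]
  exact (mul_pos (beta_pos ha hb) (Real.rpow_pos_of_pos (sub_pos.2 hst) _)).ne'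

theorem integral_sub_rpow_mul_rpow {a b t : ℝ} (ha : 0 < a) (hb : 0 < b) (ht : 0 < t) :
    ∫ x in (0 : ℝ)..t, (t - x) ^ (b - 1) * x ^ (a - 1) = beta a b * t ^ (a + b - 1) := by
  simpa using integral_sub_rpow_mul_sub_rpow ha hb ht

theorem intervalIntegrable_sub_rpow_mul_rpow {a b t : ℝ} (ha : 0 < a) (hb : 0 < b) (ht : 0 < t) :
    IntervalIntegrable (fun x => (t - x) ^ (b - 1) * x ^ (a - 1)) volume 0 t := by
  simpa using intervalIntegrable_sub_rpow_mul_sub_rpow ha hb ht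

/-! ### The Riemann-Liouville integral on functions of order t^(γ-1) -/

section

variable {X : Type*} [NormedAddCommGroup X]

/-- `g` is continuous on `(0,T]` and of order `t^(γ-1)` there. -/
structure PowContinuousOn (γ T : ℝ) (g : ℝ → X) : Prop where
  continuousOn : ContinuousOn g (Ioc 0 T)
  bound : ∃ C, ∀ t ∈ Ioc 0 T, ‖g t‖ ≤ C * t ^ (γ - 1)

variable {γ T β : ℝ} {g : ℝ → X}

theorem PowContinuousOn.mono {δ : ℝ} (hg : PowContinuousOn γ T g) (h : δ ≤ γ) :
    PowContinuousOn δ T g := by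
  refine ⟨hg.continuousOn, ?_⟩
  obtain ⟨C, hC⟩ := hg.bound
  refine ⟨|C| * T ^ (γ - δ), fun t ht => (hC t ht).trans ?_⟩
  rw [show γ - 1 = (γ - δ) + (δ - 1) by ring, Real.rpow_add ht.1, ← mul_assoc]
  have h1 : t ^ (γ - δ) ≤ T ^ (γ - δ) := Real.rpow_le_rpow ht.1.le ht.2 (by linarith)
  have h2 : 0 ≤ t ^ (δ - 1) := Real.rpow_nonneg ht.1.le _
  have h3 : 0 ≤ t ^ (γ - δ) := Real.rpow_nonneg ht.1.le _
  gcongr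
  exact le_abs_self C

theorem PowContinuousOn.of_continuousOn (hg : ContinuousOn g (Icc 0 T)) :
    PowContinuousOn 1 T g := by
  refine ⟨hg.mono Ioc_subset_Icc_self, ?_⟩
  obtain ⟨C, hC⟩ := isCompact_Icc.exists_bound_of_continuousOn hg
  exact ⟨C, fun t ht => by simpa using hC t (Ioc_subset_Icc_self ht)⟩

theorem PowContinuousOn.add {f : ℝ → X} (hf : PowContinuousOn γ T f)
    (hg : PowContinuousOn γ T g) : PowContinuousOn γ T (fun t => f t + g t) := by
  refine ⟨hf.continuousOn.add hg.continuousOn, ?_⟩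
  obtain ⟨C, hC⟩ := hf.bound
  obtain ⟨D, hD⟩ := hg.bound
  refine ⟨C + D, fun t ht => (norm_add_le _ _).trans ?_⟩
  rw [add_mul]
  exact add_le_add (hC t ht) (hD t ht)

theorem PowContinuousOn.neg (hg : PowContinuousOn γ T g) :
    PowContinuousOn γ T (fun t => -g t) :=
  ⟨hg.continuousOn.neg, by simpa using hg.bound⟩

theorem PowContinuousOn.sub {f : ℝ → X} (hf : PowContinuousOn γ T f)
    (hg : PowContinuousOn γ T g) : PowContinuousOn γ T (fun t => f t - g t) := by
  simpa only [sub_eq_add_neg] using hf.add hg.neg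

theorem PowContinuousOn.exists_nonneg_bound (hg : PowContinuousOn γ T g) :
    ∃ C, 0 ≤ C ∧ ∀ t ∈ Ioc 0 T, ‖g t‖ ≤ C * t ^ (γ - 1) := by
  obtain ⟨C, hC⟩ := hg.bound
  refine ⟨|C|, abs_nonneg C, fun t ht => (hC t ht).trans ?_⟩
  have : 0 ≤ t ^ (γ - 1) := Real.rpow_nonneg ht.1.le _
  gcongr
  exact le_abs_self C

theorem PowContinuousOn.continuousOn_Icc (hγ : 1 < γ) (hg : PowContinuousOn γ T g)
    (h0 : g 0 = 0) : ContinuousOn g (Icc 0 T) := by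
  obtain ⟨C, hC⟩ := hg.bound
  intro t ht
  rcases ht.1.eq_or_lt with rfl | ht0
  · have hlim : Tendsto (fun t : ℝ => |C| * |t| ^ (γ - 1)) (𝓝[Icc 0 T] 0) (𝓝 0) := by
      have : ContinuousAt (fun t : ℝ => |C| * |t| ^ (γ - 1)) 0 :=
        (continuousAt_const.mul (continuousAt_id.abs.rpow_const (Or.inr (by linarith))))
      have h2 := this.tendsto
      rw [abs_zero, Real.zero_rpow (by linarith), mul_zero] at h2
      exact h2.mono_left nhdsWithin_le_nhds
    rw [ContinuousWithinAt, h0]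
    refine squeeze_zero_norm' ?_ hlim
    filter_upwards [self_mem_nhdsWithin] with s hs
    rcases hs.1.eq_or_lt with rfl | hs0
    · rw [h0, norm_zero]; positivity
    · refine (hC s ⟨hs0, hs.2⟩).trans ?_
      rw [abs_of_pos hs0]
      have : 0 ≤ s ^ (γ - 1) := Real.rpow_nonneg hs0.le _
      gcongr
      exact le_abs_self C
  · refine (hg.continuousOn t ⟨ht0, ht.2⟩).mono_of_mem_nhdsWithin ?_
    filter_upwards [self_mem_nhdsWithin, mem_nhdsWithin_of_mem_nhds (Ioi_mem_nhds ht0)] with s h1 h2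
    exact ⟨h2, h1.2⟩

variable [NormedSpace ℝ X]

theorem rlIntegral_zero_right : rlIntegral β g 0 = 0 := by simp [rlIntegral]

theorem rlIntegral_congr {f : ℝ → X} {t : ℝ} (ht : 0 ≤ t) (h : ∀ x ∈ Ioo 0 t, f x = g x) :
    rlIntegral β f t = rlIntegral β g t := by
  unfold rlIntegral
  congr 1
  refine intervalIntegral.integral_congr_uIoo fun x hx => ?_
  rw [uIoo_of_le ht] at hx
  simp only [h x hx]

theorem rlIntegral_one_eq (t : ℝ) : rlIntegral 1 g t = ∫ x in (0 : ℝ)..t, g x := by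
  simp [rlIntegral]

theorem intervalIntegrable_rpow_smul (hβ : 0 < β) (hγ : 0 < γ) (hg : PowContinuousOn γ T g)
    {t : ℝ} (ht : t ∈ Icc 0 T) :
    IntervalIntegrable (fun x => (t - x) ^ (β - 1) • g x) volume 0 t := by
  rcases ht.1.eq_or_lt with rfl | h0
  · exact IntervalIntegrable.refl
  obtain ⟨C, hC⟩ := hg.bound
  refine ((intervalIntegrable_sub_rpow_mul_rpow hγ hβ h0).const_mul C).mono_fun' ?_ ?_
  · rw [uIoc_of_le ht.1]
    refine AEStronglyMeasurable.smul (Measurable.aestronglyMeasurable (by fun_prop)) ?_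
    exact (hg.continuousOn.mono (Ioc_subset_Ioc_right ht.2)).aestronglyMeasurable
      measurableSet_Ioc
  · rw [uIoc_of_le ht.1]
    refine ae_restrict_of_forall_mem measurableSet_Ioc fun x hx => ?_
    have h1 : 0 ≤ (t - x) ^ (β - 1) := Real.rpow_nonneg (by linarith [hx.2]) _
    beta_reduce
    rw [norm_smul, Real.norm_of_nonneg h1]
    calc _ ≤ (t - x) ^ (β - 1) * (C * x ^ (γ - 1)) := by
          gcongr
          exact hC x ⟨hx.1, hx.2.trans ht.2⟩
      _ = _ := by ring

theorem PowContinuousOn.intervalIntegrable (hγ : 0 < γ) (hg : PowContinuousOn γ T g)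
    {t : ℝ} (ht : t ∈ Icc 0 T) : IntervalIntegrable g volume 0 t := by
  simpa using intervalIntegrable_rpow_smul one_pos hγ hg ht

theorem rlIntegral_add {f : ℝ → X} (hβ : 0 < β) (hγ : 0 < γ) (hf : PowContinuousOn γ T f)
    (hg : PowContinuousOn γ T g) {t : ℝ} (ht : t ∈ Icc 0 T) :
    rlIntegral β (fun x => f x + g x) t = rlIntegral β f t + rlIntegral β g t := by
  unfold rlIntegral
  simp only [smul_add]
  rw [intervalIntegral.integral_add (intervalIntegrable_rpow_smul hβ hγ hf ht)
    (intervalIntegrable_rpow_smul hβ hγ hg ht), smul_add]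

theorem rlIntegral_sub {f : ℝ → X} (hβ : 0 < β) (hγ : 0 < γ) (hf : PowContinuousOn γ T f)
    (hg : PowContinuousOn γ T g) {t : ℝ} (ht : t ∈ Icc 0 T) :
    rlIntegral β (fun x => f x - g x) t = rlIntegral β f t - rlIntegral β g t := by
  unfold rlIntegral
  simp only [smul_sub]
  rw [intervalIntegral.integral_sub (intervalIntegrable_rpow_smul hβ hγ hf ht)
    (intervalIntegrable_rpow_smul hβ hγ hg ht), smul_sub]

/-- The comparison exponent b may differ from β: part of the kernel's integrability can be traded
for smallness of C, as the exponential weight requires. -/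
theorem norm_rlIntegral_le {b C t : ℝ} (hβ : 0 < β) (hb : 0 < b) (hγ : 0 < γ) (ht : 0 < t)
    (h : ∀ x ∈ Ioo 0 t, (t - x) ^ (β - 1) * ‖g x‖ ≤ C * ((t - x) ^ (b - 1) * x ^ (γ - 1))) :
    ‖rlIntegral β g t‖ ≤ 1 / Real.Gamma β * (C * (beta γ b * t ^ (γ + b - 1))) := by
  unfold rlIntegral
  have hG := Real.Gamma_pos_of_pos hβ
  rw [norm_smul, Real.norm_of_nonneg (by positivity)]
  refine mul_le_mul_of_nonneg_left ?_ (by positivity)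
  rw [← integral_sub_rpow_mul_rpow hγ hb ht, ← intervalIntegral.integral_const_mul]
  refine intervalIntegral.norm_integral_le_of_norm_le ht.le ?_
    ((intervalIntegrable_sub_rpow_mul_rpow hγ hb ht).const_mul C)
  have : ∀ᵐ x : ℝ, x ≠ t := by simp [ae_iff]
  filter_upwards [this] with x hxt hx
  have hx' : x ∈ Ioo 0 t := ⟨hx.1, lt_of_le_of_ne hx.2 hxt⟩
  rw [norm_smul, Real.norm_of_nonneg (Real.rpow_nonneg (by linarith [hx.2]) _)]
  exact h x hx'

/-- The substitution x = tu fixes the interval and the kernel. Pulling out u^(γ-1) leaves a factor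
that is bounded when g has order t^(γ-1), so continuity in t follows by dominated convergence. -/
theorem rlIntegral_eq_unit_integral {t : ℝ} (ht : 0 < t) :
    rlIntegral β g t = (t ^ (β + γ - 1) / Real.Gamma β) •
      ∫ u in (0 : ℝ)..1, ((1 - u) ^ (β - 1) * u ^ (γ - 1)) • ((t * u) ^ (1 - γ) • g (t * u)) := by
  have h := intervalIntegral.integral_comp_mul_left (a := 0) (b := 1)
    (fun x => (t - x) ^ (β - 1) • g x) ht.ne'
  rw [mul_zero, mul_one, eq_inv_smul_iff₀ ht.ne'] at h
  unfold rlIntegral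
  rw [← h, one_div, div_eq_inv_mul, mul_smul]
  congr 1
  rw [← intervalIntegral.integral_smul, ← intervalIntegral.integral_smul]
  refine intervalIntegral.integral_congr_uIoo fun u hu => ?_
  rw [uIoo_of_le zero_le_one] at hu
  rw [smul_smul, smul_smul, smul_smul]
  congr 1
  have hu1 : 0 < 1 - u := by linarith [hu.2]
  rw [show t - t * u = t * (1 - u) by ring, Real.mul_rpow ht.le hu1.le,
    Real.mul_rpow ht.le hu.1.le, show β + γ - 1 = (β - 1) + (γ - 1) + 1 by ring,
    show 1 - γ = -(γ - 1) by ring, Real.rpow_add ht, Real.rpow_add ht, Real.rpow_one,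
    Real.rpow_neg ht.le, Real.rpow_neg hu.1.le]
  have h1 : t ^ (γ - 1) ≠ 0 := (Real.rpow_pos_of_pos ht _).ne'
  have h2 : u ^ (γ - 1) ≠ 0 := (Real.rpow_pos_of_pos hu.1 _).ne'
  field_simp

theorem PowContinuousOn.rlIntegral (hβ : 0 < β) (hγ : 0 < γ) (hg : PowContinuousOn γ T g) :
    PowContinuousOn (γ + β) T (rlIntegral β g) := by
  obtain ⟨C, hC0, hC⟩ := hg.exists_nonneg_bound
  constructor
  · have key : ContinuousOn (fun t => (t ^ (β + γ - 1) / Real.Gamma β) •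
        ∫ u in (0 : ℝ)..1, ((1 - u) ^ (β - 1) * u ^ (γ - 1)) •
          ((t * u) ^ (1 - γ) • g (t * u))) (Ioc 0 T) := by
      refine ContinuousOn.smul ?_ ?_
      · exact (ContinuousOn.rpow_const continuousOn_id fun t ht => Or.inl ht.1.ne').div_const _
      have hw : ContinuousOn (fun s => s ^ (1 - γ) • g s) (Ioc 0 T) :=
        (ContinuousOn.rpow_const continuousOn_id fun t ht => Or.inl ht.1.ne').smul hg.continuousOn
      have hmaps : ∀ t ∈ Ioc 0 T, ∀ u ∈ Ioc (0 : ℝ) 1, t * u ∈ Ioc 0 T := fun t ht u hu =>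
        ⟨mul_pos ht.1 hu.1, (mul_le_of_le_one_right ht.1.le hu.2).trans ht.2⟩
      intro t₀ ht₀
      refine intervalIntegral.continuousWithinAt_of_dominated_interval
        (bound := fun u => C * ((1 - u) ^ (β - 1) * u ^ (γ - 1))) ?_ ?_ ?_ ?_
      · filter_upwards [self_mem_nhdsWithin] with t ht
        rw [uIoc_of_le zero_le_one]
        refine AEStronglyMeasurable.smul (Measurable.aestronglyMeasurable (by fun_prop)) ?_
        refine ContinuousOn.aestronglyMeasurable (f := fun u => (t * u) ^ (1 - γ) • g (t * u)) ?_
          measurableSet_Ioc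
        exact hw.comp (continuous_const_mul t).continuousOn (hmaps t ht)
      · filter_upwards [self_mem_nhdsWithin] with t ht
        refine ae_of_all _ fun u hu => ?_
        rw [uIoc_of_le zero_le_one] at hu
        have htu := hmaps t ht u hu
        have h1 : 0 ≤ (1 - u) ^ (β - 1) * u ^ (γ - 1) :=
          mul_nonneg (Real.rpow_nonneg (by linarith [hu.2]) _) (Real.rpow_nonneg hu.1.le _)
        rw [norm_smul, norm_smul, Real.norm_of_nonneg h1,
          Real.norm_of_nonneg (Real.rpow_nonneg htu.1.le _), mul_comm]
        refine mul_le_mul_of_nonneg_right ?_ h1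
        calc _ ≤ (t * u) ^ (1 - γ) * (C * (t * u) ^ (γ - 1)) := by
              gcongr
              · exact Real.rpow_nonneg htu.1.le _
              · exact hC _ htu
          _ = C * (t * u) ^ ((1 - γ) + (γ - 1)) := by rw [Real.rpow_add htu.1]; ring
          _ = C := by simp
      · exact (intervalIntegrable_sub_rpow_mul_rpow hγ hβ one_pos).const_mul C
      · refine ae_of_all _ fun u hu => ?_
        rw [uIoc_of_le zero_le_one] at hu
        refine ContinuousWithinAt.const_smul ?_ _
        exact (hw _ (hmaps t₀ ht₀ u hu)).comp (f := fun t => t * u)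
          (continuous_mul_const u).continuousWithinAt (fun t ht => hmaps t ht u hu)
    exact key.congr fun t ht => rlIntegral_eq_unit_integral ht.1
  · refine ⟨1 / Real.Gamma β * (C * beta γ β), fun t ht => ?_⟩
    refine (norm_rlIntegral_le (C := C) hβ hβ hγ ht.1 fun x hx => ?_).trans_eq (by ring)
    have := hC x ⟨hx.1, hx.2.le.trans ht.2⟩
    have h1 : 0 ≤ (t - x) ^ (β - 1) := Real.rpow_nonneg (by linarith [hx.2]) _
    calc _ ≤ (t - x) ^ (β - 1) * (C * x ^ (γ - 1)) := by gcongr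
      _ = _ := by ring

/-- Fubini on the triangle s < x < t: the inner integral in x is a beta integral, and B(β,δ) =
Γ(β)Γ(δ)/Γ(β+δ) matches the normalising constants. -/
theorem rlIntegral_rlIntegral [CompleteSpace X] {δ : ℝ} (hβ : 0 < β) (hδ : 0 < δ) (hγ : 0 < γ)
    (hg : PowContinuousOn γ T g) {t : ℝ} (ht : t ∈ Icc 0 T) :
    rlIntegral δ (rlIntegral β g) t = rlIntegral (δ + β) g t := by
  rcases ht.1.eq_or_lt with rfl | ht0
  · simp [rlIntegral]
  obtain ⟨C, hC0, hC⟩ := hg.exists_nonneg_bound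
  set μ : Measure ℝ := volume.restrict (Ioc 0 t) with hμ
  -- The indicator of s < x extends the kernel by zero to the square, where the product measure is
  -- available.
  set K : ℝ → ℝ → X := fun x s => (Iio x).indicator
    (fun s => ((t - x) ^ (δ - 1) * (x - s) ^ (β - 1)) • g s) s with hK
  have hxs : ∀ x ∈ Ioc 0 t, Ioc 0 t ∩ Iio x = Ioo 0 x := fun x hx => by
    ext s; constructor
    · rintro ⟨h1, h2⟩; exact ⟨h1.1, h2⟩
    · rintro ⟨h1, h2⟩; exact ⟨⟨h1, h2.le.trans hx.2⟩, h2⟩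
  have hinner : ∀ x ∈ Ioc 0 t, ∫ s, K x s ∂μ =
      (t - x) ^ (δ - 1) • ∫ s in (0 : ℝ)..x, (x - s) ^ (β - 1) • g s := fun x hx => by
    rw [hμ, setIntegral_indicator measurableSet_Iio, hxs x hx, ← integral_Ioc_eq_integral_Ioo,
      intervalIntegral.integral_of_le hx.1.le, ← integral_smul]
    simp only [smul_smul]
  have hmeas : AEStronglyMeasurable (Function.uncurry K) (μ.prod μ) := by
    have hgm : AEStronglyMeasurable g μ :=
      (hg.continuousOn.mono (Ioc_subset_Ioc_right ht.2)).aestronglyMeasurable measurableSet_Ioc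
    have h1 : AEStronglyMeasurable
        (fun p : ℝ × ℝ => ((t - p.1) ^ (δ - 1) * (p.1 - p.2) ^ (β - 1)) • g p.2) (μ.prod μ) :=
      AEStronglyMeasurable.smul (Measurable.aestronglyMeasurable (by fun_prop)) hgm.comp_snd
    exact h1.indicator (measurableSet_lt measurable_snd measurable_fst)
  have hnorm : ∀ x s, ‖K x s‖ = (Iio x).indicator
      (fun s => ‖((t - x) ^ (δ - 1) * (x - s) ^ (β - 1)) • g s‖) s := fun x s =>
    norm_indicator_eq_indicator_norm _ _
  have hsec : ∀ x ∈ Ioc 0 t, IntervalIntegrable (fun s => (x - s) ^ (β - 1) • g s) volume 0 x :=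
    fun x hx => intervalIntegrable_rpow_smul hβ hγ hg ⟨hx.1.le, hx.2.trans ht.2⟩
  have hint : Integrable (Function.uncurry K) (μ.prod μ) := by
    rw [integrable_prod_iff hmeas]
    constructor
    · refine ae_restrict_of_forall_mem measurableSet_Ioc fun x hx => ?_
      change Integrable ((Iio x).indicator _) μ
      rw [integrable_indicator_iff measurableSet_Iio, IntegrableOn, hμ,
        Measure.restrict_restrict measurableSet_Iio, inter_comm, hxs x hx]
      have h1 := (hsec x hx).smul ((t - x) ^ (δ - 1))
      rw [intervalIntegrable_iff_integrableOn_Ioo_of_le hx.1.le] at h1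
      refine h1.congr (ae_of_all _ fun s => ?_)
      simp [smul_smul]
    -- The inner integral of norms is again a beta integral; it is of order x^(γ+β-1), integrable
    -- against (t - x)^(δ-1).
    · have hb : IntegrableOn (fun x => C * beta γ β * ((t - x) ^ (δ - 1) * x ^ (γ + β - 1)))
          (Ioc 0 t) volume :=
        (intervalIntegrable_iff_integrableOn_Ioc_of_le ht.1).1
          ((intervalIntegrable_sub_rpow_mul_rpow (by linarith) hδ ht0).const_mul _)
      refine Integrable.mono' hb hmeas.norm.integral_prod_right' ?_
      refine ae_restrict_of_forall_mem measurableSet_Ioc fun x hx => ?_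
      rw [Real.norm_of_nonneg (integral_nonneg fun _ => norm_nonneg _)]
      simp only [Function.uncurry_apply_pair, hnorm]
      rw [hμ, setIntegral_indicator measurableSet_Iio, hxs x hx, ← integral_Ioc_eq_integral_Ioo,
        ← intervalIntegral.integral_of_le hx.1.le, show C * beta γ β * ((t - x) ^ (δ - 1) *
          x ^ (γ + β - 1)) = (t - x) ^ (δ - 1) * C * (beta γ β * x ^ (γ + β - 1)) by ring,
        ← integral_sub_rpow_mul_rpow hγ hβ hx.1, ← intervalIntegral.integral_const_mul]
      refine intervalIntegral.integral_mono_on_of_le_Ioo hx.1.le ?_ ?_ fun s hs => ?_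
      · have h1 := ((hsec x hx).smul ((t - x) ^ (δ - 1))).norm
        refine h1.congr fun s _ => ?_
        simp [smul_smul]
      · exact (intervalIntegrable_sub_rpow_mul_rpow hγ hβ hx.1).const_mul _
      · have h1 : 0 ≤ (t - x) ^ (δ - 1) := Real.rpow_nonneg (by linarith [hx.2]) _
        have h2 : 0 ≤ (x - s) ^ (β - 1) := Real.rpow_nonneg (by linarith [hs.2]) _
        rw [norm_smul, Real.norm_of_nonneg (mul_nonneg h1 h2)]
        calc _ ≤ (t - x) ^ (δ - 1) * (x - s) ^ (β - 1) * (C * s ^ (γ - 1)) := by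
              gcongr
              exact hC s ⟨hs.1, hs.2.le.trans (hx.2.trans ht.2)⟩
          _ = _ := by ring
  have hswap := integral_integral_swap hint
  have hleft : ∫ x, ∫ s, K x s ∂μ ∂μ = Real.Gamma β • Real.Gamma δ •
      rlIntegral δ (rlIntegral β g) t := by
    have hG1 := (Real.Gamma_pos_of_pos hβ).ne'
    have hG2 := (Real.Gamma_pos_of_pos hδ).ne'
    rw [rlIntegral, smul_smul (Real.Gamma δ), mul_one_div_cancel hG2, one_smul,
      ← intervalIntegral.integral_smul, intervalIntegral.integral_of_le ht.1]
    refine setIntegral_congr_fun measurableSet_Ioc fun x hx => ?_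
    rw [hinner x hx, rlIntegral, smul_comm (Real.Gamma β), smul_smul (Real.Gamma β),
      mul_one_div_cancel hG1, one_smul]
  have hright : ∫ s, ∫ x, K x s ∂μ ∂μ = (Real.Gamma β * Real.Gamma δ) •
      rlIntegral (δ + β) g t := by
    rw [rlIntegral, smul_smul, ← intervalIntegral.integral_smul,
      intervalIntegral.integral_of_le ht.1, integral_Ioc_eq_integral_Ioo, hμ,
      integral_Ioc_eq_integral_Ioo]
    refine setIntegral_congr_fun measurableSet_Ioo fun s hs => ?_
    have h1 : ∀ x, K x s = (Ioi s).indicator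
        (fun x => ((t - x) ^ (δ - 1) * (x - s) ^ (β - 1)) • g s) x := fun x => by
      simp [hK, indicator]
    have h2 : Ioc 0 t ∩ Ioi s = Ioc s t := by
      ext x; constructor
      · rintro ⟨h1, h2⟩; exact ⟨h2, h1.2⟩
      · rintro ⟨h1, h2⟩; exact ⟨⟨hs.1.trans h1, h2⟩, h1⟩
    simp only [h1]
    rw [setIntegral_indicator measurableSet_Ioi, h2, ← intervalIntegral.integral_of_le hs.2.le,
      intervalIntegral.integral_smul_const, integral_sub_rpow_mul_sub_rpow hβ hδ hs.2, smul_smul,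
      beta, add_comm δ β]
    congr 1
    ring
  rw [hleft, hright, smul_smul] at hswap
  exact smul_right_injective X (mul_pos (Real.Gamma_pos_of_pos hβ)
    (Real.Gamma_pos_of_pos hδ)).ne' hswap

/-- Since 0 ≤ a ≤ 1, y^a is at most max(1, y), hence at most exp y. -/
theorem Real.exp_neg_le_rpow_neg {y a : ℝ} (hy : 0 < y) (ha0 : 0 ≤ a) (ha1 : a ≤ 1) :
    Real.exp (-y) ≤ y ^ (-a) := by
  rw [Real.exp_neg, Real.rpow_neg hy.le]
  refine inv_anti₀ (Real.rpow_pos_of_pos hy _) ?_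
  rcases le_total y 1 with h | h
  · exact (Real.rpow_le_one hy.le h ha0).trans (Real.one_le_exp hy.le)
  · calc y ^ a ≤ y ^ (1 : ℝ) := Real.rpow_le_rpow_of_exponent_le h ha1
      _ = y := Real.rpow_one y
      _ ≤ Real.exp y := by linarith [Real.add_one_le_exp y]

/-- In an exponentially weighted norm, the Riemann-Liouville integral is as small as desired. -/
theorem exists_exp_weight {α : ℝ} (hα₀ : 0 < α) (hα₁ : α < 1) (T : ℝ) (hγ : 0 < γ) (X : Type*)
    [NormedAddCommGroup X] [NormedSpace ℝ X] (L : ℝ) :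
    ∃ k : ℝ, 0 ≤ k ∧ ∀ (u : ℝ → X) (B : ℝ), 0 ≤ B →
      ∀ t ∈ Ioc 0 T, (∀ s ∈ Ioo 0 t, ‖u s‖ ≤ L * (B * (Real.exp (k * s) * s ^ (γ - 1)))) →
        ‖_root_.rlIntegral α u t‖ ≤ B / 2 * (Real.exp (k * t) * t ^ (γ - 1)) := by
  have hG := Real.Gamma_pos_of_pos hα₀
  have ha : 0 < α / 2 := by linarith
  -- Half of the order α is spent: exp(-k(t-s)) ≤ (k(t-s))^(-α/2) leaves the integrable kernel
  -- (t-s)^(α/2-1) and the factor k^(-α/2), which tends to 0.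
  have hlim : Tendsto (fun k : ℝ => |L| * (1 / Real.Gamma α * (k ^ (-(α / 2)) *
      (beta γ (α / 2) * T ^ (α / 2))))) atTop (𝓝 0) := by
    have h1 := tendsto_rpow_neg_atTop ha
    have := (((h1.mul_const (beta γ (α / 2) * T ^ (α / 2))).const_mul
      (1 / Real.Gamma α)).const_mul |L|)
    simpa using this
  obtain ⟨k, hk, hk0⟩ := ((hlim.eventually_lt_const (by norm_num : (0 : ℝ) < 1 / 2)).and
    (eventually_gt_atTop 0)).exists
  refine ⟨k, hk0.le, fun u B hB t ht hu => ?_⟩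
  have hkey := norm_rlIntegral_le (g := u) (b := α / 2) (γ := γ) (t := t)
    (C := |L| * (B * Real.exp (k * t) * k ^ (-(α / 2)))) hα₀ ha hγ ht.1 fun s hs => by
      have hts : 0 < t - s := by linarith [hs.2]
      have h1 : 0 ≤ (t - s) ^ (α - 1) := Real.rpow_nonneg hts.le _
      have h2 : Real.exp (k * s) ≤ Real.exp (k * t) * (k ^ (-(α / 2)) * (t - s) ^ (-(α / 2))) := by
        rw [← Real.mul_rpow hk0.le hts.le]
        calc Real.exp (k * s) = Real.exp (k * t) * Real.exp (-(k * (t - s))) := by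
              rw [← Real.exp_add]; ring_nf
          _ ≤ _ := by
              gcongr
              exact Real.exp_neg_le_rpow_neg (mul_pos hk0 hts) (by linarith) (by linarith)
      have h3 : 0 ≤ s ^ (γ - 1) := Real.rpow_nonneg hs.1.le _
      calc _ ≤ (t - s) ^ (α - 1) * (|L| * (B * (Real.exp (k * t) *
            (k ^ (-(α / 2)) * (t - s) ^ (-(α / 2))) * s ^ (γ - 1)))) := by
            gcongr
            exact (hu s hs).trans (by gcongr; exact le_abs_self L)
        _ = |L| * (B * Real.exp (k * t) * k ^ (-(α / 2))) *
            (((t - s) ^ (α - 1) * (t - s) ^ (-(α / 2))) * s ^ (γ - 1)) := by ring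
        _ = _ := by rw [← Real.rpow_add hts]; ring_nf
  have htγ : 0 < t ^ (γ - 1) := Real.rpow_pos_of_pos ht.1 _
  have hbeta := beta_pos hγ ha
  have hka : 0 < k ^ (-(α / 2)) := Real.rpow_pos_of_pos hk0 _
  calc _ ≤ _ := hkey
    _ = |L| * (1 / Real.Gamma α * (k ^ (-(α / 2)) * (beta γ (α / 2) * t ^ (α / 2)))) *
        (B * (Real.exp (k * t) * t ^ (γ - 1))) := by
        rw [show γ + α / 2 - 1 = α / 2 + (γ - 1) by ring, Real.rpow_add ht.1]; ring
    _ ≤ |L| * (1 / Real.Gamma α * (k ^ (-(α / 2)) * (beta γ (α / 2) * T ^ (α / 2)))) *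
        (B * (Real.exp (k * t) * t ^ (γ - 1))) := by
        have := Real.rpow_le_rpow ht.1.le ht.2 ha.le
        gcongr
    _ ≤ 1 / 2 * (B * (Real.exp (k * t) * t ^ (γ - 1))) := by
        gcongr
    _ = _ := by ring

end

/-! ### Caputo versus Volterra; solvability and Grönwall for Volterra equations -/

section

variable {X : Type*} [NormedAddCommGroup X] [NormedSpace ℝ X] {γ T α : ℝ}

theorem hasDerivWithinAt_integral_Icc [CompleteSpace X] {v : ℝ → X} (hγ : 0 < γ)
    (hv : PowContinuousOn γ T v) {t : ℝ} (ht : t ∈ Icc 0 T)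
    (hc : ContinuousWithinAt v (Icc 0 T) t) :
    HasDerivWithinAt (fun t => ∫ x in (0 : ℝ)..t, v x) (v t) (Icc 0 T) t := by
  have : Fact (t ∈ Icc 0 T) := ⟨ht⟩
  refine intervalIntegral.integral_hasDerivWithinAt_right (hv.intervalIntegrable hγ ht) ?_ hc
  refine ⟨Icc 0 T, self_mem_nhdsWithin, ?_⟩
  rw [← Measure.restrict_congr_set (Ioc_ae_eq_Icc (α := ℝ) (μ := volume))]
  exact hv.continuousOn.aestronglyMeasurable measurableSet_Ioc

omit [NormedSpace ℝ X] in
theorem PowContinuousOn.continuousWithinAt {v : ℝ → X} (hv : PowContinuousOn γ T v) {t : ℝ}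
    (ht : t ∈ Ioc 0 T) : ContinuousWithinAt v (Icc 0 T) t := by
  refine (hv.continuousOn t ht).mono_of_mem_nhdsWithin ?_
  filter_upwards [self_mem_nhdsWithin, mem_nhdsWithin_of_mem_nhds (Ioi_mem_nhds ht.1)]
    with s h1 h2
  exact ⟨h2, h1.2⟩

/-- This cancels I^1, by differentiating both primitives at points t > 0, where the integrands are
continuous. -/
theorem eqOn_of_integral_eq [CompleteSpace X] {γ' : ℝ} {u v : ℝ → X} (hγ : 0 < γ) (hγ' : 0 < γ')
    (hu : PowContinuousOn γ T u) (hv : PowContinuousOn γ' T v)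
    (h : ∀ t ∈ Icc 0 T, ∫ x in (0 : ℝ)..t, u x = ∫ x in (0 : ℝ)..t, v x) :
    ∀ t ∈ Ioc 0 T, u t = v t := by
  intro t ht
  have ht' := Ioc_subset_Icc_self ht
  have h1 := hasDerivWithinAt_integral_Icc hγ hu ht' (hu.continuousWithinAt ht)
  have h2 := hasDerivWithinAt_integral_Icc hγ' hv ht' (hv.continuousWithinAt ht)
  exact (uniqueDiffOn_Icc (ht.1.trans_le ht.2) t ht').eq_deriv _ h1 (h2.congr h (h t ht'))

theorem eq_add_integral_of_hasDerivAt [CompleteSpace X] {u v : ℝ → X} (hγ : 0 < γ)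
    (hv : PowContinuousOn γ T v)
    (hu : ContinuousOn u (Icc 0 T)) (h : ∀ t ∈ Ioo 0 T, HasDerivAt u (v t) t) {t : ℝ}
    (ht : t ∈ Icc 0 T) : u t = u 0 + ∫ x in (0 : ℝ)..t, v x := by
  rw [intervalIntegral.integral_eq_sub_of_hasDerivAt_of_le ht.1
    (hu.mono (Icc_subset_Icc_right ht.2)) (fun x hx => h x ⟨hx.1, hx.2.trans_le ht.2⟩)
    (hv.intervalIntegrable hγ ht)]
  abel

/-- Integrating the Caputo equation gives I^(1-α)(z - z(0)) = I^1 F; applying I^α and commuting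
gives I^1(z - z(0)) = I^1 I^α F, and I^1 cancels. Conversely, I^(1-α) applied to z - ρ = I^α F is
the primitive I^1 F, differentiable up to the end points because F(t, z(t)) is continuous on [0,T].
-/
theorem isCaputoSolution_iff_isVolterraSolution [CompleteSpace X] (hα₀ : 0 < α) (hα₁ : α < 1)
    (hT : 0 < T) {F : ℝ → X → X} {U : Set X} {ρ : X} {z : ℝ → X}
    (hF : ContinuousOn z (Icc 0 T) → (∀ t ∈ Icc 0 T, z t ∈ U) →
      ContinuousOn (fun t => F t (z t)) (Icc 0 T)) :
    IsCaputoSolution α T F U ρ z ↔ IsVolterraSolution α T F U ρ z := by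
  have h0 : (0 : ℝ) ∈ Icc 0 T := ⟨le_rfl, hT.le⟩
  have hβ : 0 < 1 - α := by linarith
  constructor
  · rintro ⟨hc, hU, heq, hi⟩
    have hFc := hF hc hU
    have hP := PowContinuousOn.of_continuousOn hFc
    have hz : PowContinuousOn 1 T (fun x => z x - z 0) :=
      .of_continuousOn (hc.sub continuousOn_const)
    have hR : ∀ t ∈ Icc 0 T, rlIntegral (1 - α) (fun x => z x - z 0) t =
        rlIntegral 1 (fun x => F x (z x)) t := by
      intro t ht
      rw [rlIntegral_one_eq, eq_add_integral_of_hasDerivAt one_pos hP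
        (fun s hs => (heq s hs).continuousWithinAt)
        (fun s hs => (heq s (Ioo_subset_Icc_self hs)).hasDerivAt (Icc_mem_nhds hs.1 hs.2)) ht,
        rlIntegral_zero_right, zero_add]
    have hS : ∀ t ∈ Icc 0 T, ∫ x in (0 : ℝ)..t, (z x - z 0) =
        ∫ x in (0 : ℝ)..t, rlIntegral α (fun x => F x (z x)) x := by
      intro t ht
      rw [← rlIntegral_one_eq, ← rlIntegral_one_eq, rlIntegral_rlIntegral hα₀ one_pos one_pos hP ht,
        add_comm 1 α, ← rlIntegral_rlIntegral one_pos hα₀ one_pos hP ht]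
      nth_rewrite 1 [show (1 : ℝ) = α + (1 - α) by ring]
      rw [← rlIntegral_rlIntegral hβ hα₀ one_pos hz ht]
      exact rlIntegral_congr ht.1 fun x hx => hR x ⟨hx.1.le, hx.2.le.trans ht.2⟩
    refine ⟨hc, hU, fun t ht => ?_⟩
    rcases ht.1.eq_or_lt with rfl | ht0
    · rw [rlIntegral_zero_right, add_zero, hi]
    · have := eqOn_of_integral_eq one_pos (by linarith) hz (hP.rlIntegral hα₀ one_pos) hS t
        ⟨ht0, ht.2⟩
      rw [← this, hi]
      abel
  · rintro ⟨hc, hU, heq⟩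
    have hFc := hF hc hU
    have hP := PowContinuousOn.of_continuousOn hFc
    have hi : z 0 = ρ := by rw [heq 0 h0, rlIntegral_zero_right, add_zero]
    refine ⟨hc, hU, fun t ht => ?_, hi⟩
    have key : ∀ t ∈ Icc 0 T, rlIntegral (1 - α) (fun x => z x - z 0) t =
        ∫ x in (0 : ℝ)..t, F x (z x) := by
      intro t ht
      rw [← rlIntegral_one_eq]
      nth_rewrite 2 [show (1 : ℝ) = (1 - α) + α by ring]
      rw [← rlIntegral_rlIntegral hα₀ hβ one_pos hP ht]
      refine rlIntegral_congr ht.1 fun x hx => ?_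
      rw [heq x ⟨hx.1.le, hx.2.le.trans ht.2⟩, hi, add_sub_cancel_left]
    exact (hasDerivWithinAt_integral_Icc one_pos hP ht (hFc t ht)).congr key (key t ht)

omit [NormedSpace ℝ X] in
theorem PowContinuousOn.lipschitz_comp {F : ℝ → X → X} {L : ℝ} {v : ℝ → X}
    (hF : ContinuousOn (Function.uncurry F) (Ioc 0 T ×ˢ univ))
    (hL : ∀ t ∈ Ioc 0 T, ∀ x y, ‖F t x - F t y‖ ≤ L * ‖x - y‖)
    (hF0 : ∃ C, ∀ t ∈ Ioc 0 T, ‖F t 0‖ ≤ C * t ^ (γ - 1)) (hv : PowContinuousOn γ T v) :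
    PowContinuousOn γ T (fun t => F t (v t)) := by
  constructor
  · exact hF.comp (continuousOn_id.prodMk hv.continuousOn) fun t ht => ⟨ht, mem_univ _⟩
  · obtain ⟨C, hC⟩ := hF0
    obtain ⟨D, hD0, hD⟩ := hv.exists_nonneg_bound
    refine ⟨C + |L| * D, fun t ht => ?_⟩
    calc ‖F t (v t)‖ = ‖F t 0 + (F t (v t) - F t 0)‖ := by congr 1; abel
      _ ≤ ‖F t 0‖ + ‖F t (v t) - F t 0‖ := norm_add_le _ _
      _ ≤ C * t ^ (γ - 1) + |L| * (D * t ^ (γ - 1)) := by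
        refine add_le_add (hC t ht) ((hL t ht _ _).trans ?_)
        rw [sub_zero]
        have := hD t ht
        gcongr
        exact le_abs_self L
      _ = _ := by ring

/-- Global solvability of weakly singular Volterra equations with a Lipschitz right-hand side. -/
theorem exists_volterra_solution [CompleteSpace X] (hα₀ : 0 < α) (hα₁ : α < 1) (hγ : 0 < γ)
    {F : ℝ → X → X} {g : ℝ → X} {L : ℝ} (hg : PowContinuousOn γ T g)
    (hF : ContinuousOn (Function.uncurry F) (Ioc 0 T ×ˢ univ))
    (hL : ∀ t ∈ Ioc 0 T, ∀ x y, ‖F t x - F t y‖ ≤ L * ‖x - y‖)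
    (hF0 : ∃ C, ∀ t ∈ Ioc 0 T, ‖F t 0‖ ≤ C * t ^ (γ - 1)) :
    ∃ v : ℝ → X, PowContinuousOn γ T v ∧
      ∀ t ∈ Ioc 0 T, v t = g t + rlIntegral α (fun s => F s (v s)) t := by
  obtain ⟨k, hk0, hk⟩ := exists_exp_weight hα₀ hα₁ T hγ X |L|
  have hL' : ∀ t ∈ Ioc 0 T, ∀ x y, ‖F t x - F t y‖ ≤ |L| * ‖x - y‖ := fun t ht x y =>
    (hL t ht x y).trans (by gcongr; exact le_abs_self L)
  set φ : ℝ → ℝ := fun t => Real.exp (k * t) * t ^ (γ - 1) with hφ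
  have hφpos : ∀ t ∈ Ioc 0 T, 0 < φ t := fun t ht =>
    mul_pos (Real.exp_pos _) (Real.rpow_pos_of_pos ht.1 _)
  have hφc : ContinuousOn φ (Ioc 0 T) :=
    (Continuous.continuousOn (by fun_prop)).mul
      (ContinuousOn.rpow_const continuousOn_id fun t ht => Or.inl ht.1.ne')
  have hφle : ∀ t ∈ Ioc 0 T, t ^ (γ - 1) ≤ φ t := fun t ht =>
    le_mul_of_one_le_left (Real.rpow_nonneg ht.1.le _) (Real.one_le_exp (mul_nonneg hk0 ht.1.le))
  have hφge : ∀ t ∈ Ioc 0 T, φ t ≤ Real.exp (k * T) * t ^ (γ - 1) := fun t ht => by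
    have := Real.rpow_nonneg ht.1.le (γ - 1)
    have := ht.2
    simp only [hφ]
    gcongr
  -- An unknown v = φ w is encoded by the bounded continuous w on (0,T], so that the sup norm of w
  -- is the weighted norm of v and completeness comes for free.
  let V := BoundedContinuousFunction (Ioc (0 : ℝ) T) X
  let ext : V → ℝ → X := fun w s => if h : s ∈ Ioc 0 T then φ s • w ⟨s, h⟩ else 0
  have hext : ∀ (w : V) (s : Ioc (0 : ℝ) T), ext w s = φ s • w s := fun w s => by
    simp only [ext, dif_pos s.2]
  have hextP : ∀ w : V, PowContinuousOn γ T (ext w) := fun w => by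
    constructor
    · rw [continuousOn_iff_continuous_domRestrict] at hφc ⊢
      exact (hφc.smul w.continuous).congr fun s => (hext w s).symm
    · refine ⟨‖w‖ * Real.exp (k * T), fun t ht => ?_⟩
      rw [hext w ⟨t, ht⟩, norm_smul, Real.norm_of_nonneg (hφpos t ht).le]
      calc _ ≤ Real.exp (k * T) * t ^ (γ - 1) * ‖w‖ := by
            have h1 := (hφpos t ht).le.trans (hφge t ht)
            gcongr
            exacts [hφge t ht, w.norm_coe_le_norm _]
        _ = _ := by ring
  let R : V → ℝ → X := fun w t => g t + rlIntegral α (fun s => F s (ext w s)) t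
  have hFP : ∀ w : V, PowContinuousOn γ T (fun s => F s (ext w s)) := fun w =>
    (hextP w).lipschitz_comp hF hL hF0
  have hRP : ∀ w : V, PowContinuousOn γ T (R w) := fun w =>
    hg.add (((hFP w).rlIntegral hα₀ hγ).mono (by linarith))
  have hbd : ∀ w : V, ∃ C, ∀ t : Ioc (0 : ℝ) T, ‖(φ t)⁻¹ • R w t‖ ≤ C := fun w => by
    obtain ⟨C, hC0, hC⟩ := (hRP w).exists_nonneg_bound
    refine ⟨C, fun t => ?_⟩
    have hp := hφpos t t.2
    rw [norm_smul, norm_inv, Real.norm_of_nonneg hp.le, inv_mul_le_iff₀ hp, mul_comm]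
    exact (hC t t.2).trans (by gcongr; exact hφle t t.2)
  let P : V → V := fun w => BoundedContinuousFunction.ofNormedAddCommGroup
    (fun t : Ioc (0 : ℝ) T => (φ t)⁻¹ • R w t)
    (by
      have h1 := hφc.inv₀ fun t ht => (hφpos t ht).ne'
      have h2 := h1.smul (hRP w).continuousOn
      rw [continuousOn_iff_continuous_domRestrict] at h2
      exact h2)
    (hbd w).choose (hbd w).choose_spec
  have hP : ∀ w (t : Ioc (0 : ℝ) T), P w t = (φ t)⁻¹ • R w t := fun w t => rfl
  have hcontr : ContractingWith (1 / 2) P := by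
    refine ⟨by norm_num, LipschitzWith.of_dist_le_mul fun w₁ w₂ => ?_⟩
    rw [BoundedContinuousFunction.dist_le (by positivity)]
    intro t
    have hp := hφpos t t.2
    have ht' := Ioc_subset_Icc_self t.2
    rw [hP, hP, dist_eq_norm, ← smul_sub, norm_smul, norm_inv, Real.norm_of_nonneg hp.le,
      inv_mul_le_iff₀ hp]
    simp only [R]
    rw [add_sub_add_left_eq_sub, ← rlIntegral_sub hα₀ hγ (hFP w₁) (hFP w₂) ht']
    refine (hk _ (dist w₁ w₂) dist_nonneg t t.2 fun s hs => ?_).trans_eq ?_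
    · have hs' : s ∈ Ioc 0 T := ⟨hs.1, hs.2.le.trans t.2.2⟩
      refine (hL' s hs' _ _).trans ?_
      rw [hext w₁ ⟨s, hs'⟩, hext w₂ ⟨s, hs'⟩, ← smul_sub, norm_smul,
        Real.norm_of_nonneg (hφpos s hs').le, mul_comm (φ s), ← dist_eq_norm]
      have := (hφpos s hs').le
      gcongr
      exact BoundedContinuousFunction.dist_coe_le_dist _
    · push_cast
      ring
  have : Nonempty V := ⟨0⟩
  have hfix : P (hcontr.fixedPoint P) = hcontr.fixedPoint P := hcontr.fixedPoint_isFixedPt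
  refine ⟨ext (hcontr.fixedPoint P), hextP _, fun t ht => ?_⟩
  have h1 := congrArg (fun w : V => w ⟨t, ht⟩) hfix
  simp only [hP] at h1
  rw [hext _ ⟨t, ht⟩, ← h1, smul_inv_smul₀ (hφpos t ht).ne']

/-- Geometric decay of a sequence of functions dominated by a weakly singular Volterra
recursion with source terms. -/
theorem exists_volterra_recursion_bound (hα₀ : 0 < α) (hα₁ : α < 1) (hγ : 0 < γ)
    (T : ℝ) (X : Type*) [NormedAddCommGroup X] [NormedSpace ℝ X] (L : ℝ) :
    ∃ K : ℝ, 1 ≤ K ∧ ∀ (e w : ℕ → ℝ → X) (A B : ℝ), 0 ≤ A → 0 ≤ B →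
      (∀ t ∈ Ioc 0 T, ‖e 0 t‖ ≤ B * t ^ (γ - 1)) →
      (∀ n, ∀ t ∈ Ioc 0 T, ‖w n t‖ ≤ L * ‖e n t‖) →
      (∀ n, ∀ t ∈ Ioc 0 T, ‖e (n + 1) t‖ ≤ A * t ^ (γ - 1) + ‖rlIntegral α (w n) t‖) →
      ∀ n, ∀ t ∈ Ioc 0 T, ‖e n t‖ ≤ (2 * A + B / 2 ^ n) * K * t ^ (γ - 1) := by
  obtain ⟨k, hk0, hk⟩ := exists_exp_weight hα₀ hα₁ T hγ X |L|
  refine ⟨Real.exp (k * |T|), Real.one_le_exp (mul_nonneg hk0 (abs_nonneg T)),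
    fun e w A B hA hB h0 hw hrec n t ht => ?_⟩
  have key : ∀ n, ∀ t ∈ Ioc 0 T,
      ‖e n t‖ ≤ (2 * A + B / 2 ^ n) * (Real.exp (k * t) * t ^ (γ - 1)) := by
    intro n
    induction n with
    | zero =>
      intro t ht
      have h1 : 0 ≤ t ^ (γ - 1) := Real.rpow_nonneg ht.1.le _
      have h2 : 1 ≤ Real.exp (k * t) := Real.one_le_exp (mul_nonneg hk0 ht.1.le)
      refine (h0 t ht).trans ?_
      have h3 : t ^ (γ - 1) ≤ Real.exp (k * t) * t ^ (γ - 1) := le_mul_of_one_le_left h1 h2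
      rw [pow_zero, div_one]
      exact mul_le_mul (by linarith) h3 h1 (by linarith)
    | succ n ih =>
      intro t ht
      have h1 : 0 ≤ t ^ (γ - 1) := Real.rpow_nonneg ht.1.le _
      have h2 : 1 ≤ Real.exp (k * t) := Real.one_le_exp (mul_nonneg hk0 ht.1.le)
      have h3 := hk (w n) (2 * A + B / 2 ^ n) (by positivity) t ht fun s hs => by
        have hs' : s ∈ Ioc 0 T := ⟨hs.1, hs.2.le.trans ht.2⟩
        calc _ ≤ L * ‖e n s‖ := hw n s hs'
          _ ≤ |L| * ‖e n s‖ := by gcongr; exact le_abs_self L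
          _ ≤ _ := by gcongr; exact ih s hs'
      have h4 : A * t ^ (γ - 1) ≤ A * (Real.exp (k * t) * t ^ (γ - 1)) := by
        gcongr
        exact le_mul_of_one_le_left h1 h2
      -- The bounds a_n = 2A + B/2^n reproduce themselves: A + a_n/2 = a_(n+1).
      refine (hrec n t ht).trans ((add_le_add h4 h3).trans_eq ?_)
      rw [pow_succ]
      field_simp
      ring
  refine (key n t ht).trans ?_
  have h1 : 0 ≤ t ^ (γ - 1) := Real.rpow_nonneg ht.1.le _
  rw [mul_assoc]
  have : t ≤ |T| := ht.2.trans (le_abs_self T)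
  gcongr

/-- Weakly singular Grönwall inequality. -/
theorem exists_volterra_gronwall (hα₀ : 0 < α) (hα₁ : α < 1) (T : ℝ) (X : Type*)
    [NormedAddCommGroup X] [NormedSpace ℝ X] (L : ℝ) :
    ∃ K : ℝ, 0 ≤ K ∧ ∀ (e w : ℝ → X) (A : ℝ), 0 ≤ A → ContinuousOn e (Icc 0 T) →
      (∀ t ∈ Icc 0 T, ‖w t‖ ≤ L * ‖e t‖) →
      (∀ t ∈ Icc 0 T, ‖e t‖ ≤ A + ‖rlIntegral α w t‖) →
      ∀ t ∈ Icc 0 T, ‖e t‖ ≤ K * A := by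
  obtain ⟨K, hK1, hK⟩ := exists_volterra_recursion_bound hα₀ hα₁ one_pos T X L
  refine ⟨2 * K, by linarith, fun e w A hA hc hw he t ht => ?_⟩
  obtain ⟨B, hB0, hB⟩ := (PowContinuousOn.of_continuousOn hc).exists_nonneg_bound
  rcases ht.1.eq_or_lt with rfl | ht0
  · have := he 0 ht
    rw [rlIntegral_zero_right, norm_zero, add_zero] at this
    nlinarith
  -- A constant sequence satisfies the recursion; letting n tend to infinity removes the a priori
  -- bound B.
  have h1 := fun n => hK (fun _ => e) (fun _ => w) A B hA hB0 hB
    (fun _ t ht => hw t (Ioc_subset_Icc_self ht))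
    (fun _ t ht => by simpa using he t (Ioc_subset_Icc_self ht)) n t ⟨ht0, ht.2⟩
  have hlim : Tendsto (fun n : ℕ => (2 * A + B / 2 ^ n) * K * t ^ ((1 : ℝ) - 1)) atTop
      (𝓝 ((2 * A + B * 0) * K * t ^ ((1 : ℝ) - 1))) := by
    have h2 : Tendsto (fun n : ℕ => B / (2 : ℝ) ^ n) atTop (𝓝 (B * 0)) := by
      simp only [div_eq_mul_inv, ← inv_pow]
      exact (tendsto_pow_atTop_nhds_zero_of_lt_one (by norm_num) (by norm_num)).const_mul B
    exact ((h2.const_add _).mul_const _).mul_const _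
  have := ge_of_tendsto' hlim h1
  simp only [sub_self, Real.rpow_zero] at this
  linarith

end

/-! ### Cutoff of vector fields and uniformity near a trajectory -/

section

variable {E Y : Type*} [NormedAddCommGroup E] [NormedSpace ℝ E] [NormedAddCommGroup Y]
  [NormedSpace ℝ Y] {T : ℝ} {U C : Set E} {G : ℝ × E → Y}

omit [NormedSpace ℝ E] in
theorem prod_univ_nhdsWithin_of_mem (hU : IsOpen U) {p : ℝ × E} (hp : p.2 ∈ U) (s : Set ℝ) :
    s ×ˢ U ∈ 𝓝[s ×ˢ univ] p := by
  have h1 : (Prod.snd ⁻¹' U : Set (ℝ × E)) ∈ 𝓝 p := (hU.preimage continuous_snd).mem_nhds hp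
  filter_upwards [self_mem_nhdsWithin, mem_nhdsWithin_of_mem_nhds h1] with q h2 h3
  exact ⟨h2.1, h3⟩

omit [NormedSpace ℝ E] [NormedSpace ℝ Y] in
theorem eventually_eq_zero_of_notMem (hC : IsClosed C)
    (h0 : ∀ t ∈ Icc 0 T, ∀ x ∉ C, G (t, x) = 0) {p : ℝ × E} (hp : p.2 ∉ C) :
    G =ᶠ[𝓝[Icc 0 T ×ˢ univ] p] fun _ => 0 := by
  have h1 : (Prod.snd ⁻¹' Cᶜ : Set (ℝ × E)) ∈ 𝓝 p :=
    (hC.isOpen_compl.preimage continuous_snd).mem_nhds hp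
  filter_upwards [self_mem_nhdsWithin, mem_nhdsWithin_of_mem_nhds h1] with q h2 h3
  exact h0 q.1 h2.1 q.2 h3

omit [NormedSpace ℝ E] [NormedSpace ℝ Y] in
-- A point over C lies over the open set U, and any other point has a neighbourhood where G
-- vanishes, so continuity is local in either case.
theorem continuousOn_prod_univ_of_eq_zero (hU : IsOpen U) (hC : IsClosed C) (hCU : C ⊆ U)
    (hG : ContinuousOn G (Icc 0 T ×ˢ U)) (h0 : ∀ t ∈ Icc 0 T, ∀ x ∉ C, G (t, x) = 0) :
    ContinuousOn G (Icc 0 T ×ˢ univ) := by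
  intro p hp
  by_cases hx : p.2 ∈ C
  · exact (hG p ⟨hp.1, hCU hx⟩).mono_of_mem_nhdsWithin
      (prod_univ_nhdsWithin_of_mem hU (hCU hx) _)
  · exact continuousWithinAt_const.congr_of_eventuallyEq (eventually_eq_zero_of_notMem hC h0 hx)
      (h0 p.1 hp.1 p.2 hx)

theorem contDiffOn_prod_univ_of_eq_zero (hU : IsOpen U) (hC : IsClosed C) (hCU : C ⊆ U)
    (hG : ContDiffOn ℝ 1 G (Icc 0 T ×ˢ U)) (h0 : ∀ t ∈ Icc 0 T, ∀ x ∉ C, G (t, x) = 0) :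
    ContDiffOn ℝ 1 G (Icc 0 T ×ˢ univ) := by
  intro p hp
  by_cases hx : p.2 ∈ C
  · exact (hG p ⟨hp.1, hCU hx⟩).mono_of_mem_nhdsWithin
      (prod_univ_nhdsWithin_of_mem hU (hCU hx) _)
  · exact contDiffWithinAt_const.congr_of_eventuallyEq (eventually_eq_zero_of_notMem hC h0 hx)
      (h0 p.1 hp.1 p.2 hx)

omit [NormedSpace ℝ E] [NormedSpace ℝ Y] in
theorem exists_bound_of_eq_zero (hC : IsCompact C) (hG : ContinuousOn G (Icc 0 T ×ˢ univ))
    (h0 : ∀ t ∈ Icc 0 T, ∀ x ∉ C, G (t, x) = 0) :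
    ∃ L, 0 ≤ L ∧ ∀ t ∈ Icc 0 T, ∀ x, ‖G (t, x)‖ ≤ L := by
  obtain ⟨L, hL⟩ := (isCompact_Icc.prod hC).exists_bound_of_continuousOn
    (hG.mono (prod_mono_right (subset_univ _)))
  refine ⟨|L|, abs_nonneg L, fun t ht x => ?_⟩
  by_cases hx : x ∈ C
  · exact (hL (t, x) ⟨ht, hx⟩).trans (le_abs_self L)
  · rw [h0 t ht x hx, norm_zero]
    exact abs_nonneg L

/-- A vector field that is `C¹` in space on `[0,T] × U` agrees, near a compact subset of `U`, with
a field that is `C¹` in space and globally Lipschitz. -/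
theorem exists_cutoff [FiniteDimensional ℝ E] (hU : IsOpen U) {f : ℝ → E → E}
    (hf : ContinuousOn (fun p : ℝ × E => f p.1 p.2) (Icc 0 T ×ˢ U))
    (hfd : ∀ t ∈ Icc 0 T, ∀ x ∈ U, DifferentiableAt ℝ (f t) x)
    (hf' : ContinuousOn (fun p : ℝ × E => fderiv ℝ (f p.1) p.2) (Icc 0 T ×ˢ U))
    {K : Set E} (hK : IsCompact K) (hKU : K ⊆ U) :
    ∃ (F : ℝ → E → E) (V : Set E) (L : ℝ), IsOpen V ∧ K ⊆ V ∧ V ⊆ U ∧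
      (∀ t, ∀ x ∈ V, F t x = f t x) ∧
      ContinuousOn (fun p : ℝ × E => F p.1 p.2) (Icc 0 T ×ˢ univ) ∧
      (∀ t ∈ Icc 0 T, Differentiable ℝ (F t)) ∧
      ContinuousOn (fun p : ℝ × E => fderiv ℝ (F p.1) p.2) (Icc 0 T ×ˢ univ) ∧
      (∀ t ∈ Icc 0 T, ∀ x, ‖fderiv ℝ (F t) x‖ ≤ L) ∧
      (∀ t ∈ Icc 0 T, ∀ x y, ‖F t x - F t y‖ ≤ L * ‖x - y‖) ∧
      (ContDiffOn ℝ 1 (fun p : ℝ × E => f p.1 p.2) (Icc 0 T ×ˢ U) →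
        ContDiffOn ℝ 1 (fun p : ℝ × E => F p.1 p.2) (Icc 0 T ×ˢ univ)) := by
  -- The new field is χ f, with χ equal to 1 near K and 0 off the compact C inside U.
  obtain ⟨C, hC, hKC, hCU⟩ := exists_compact_between hK hU hKU
  obtain ⟨χ, hχ1, hχ0, -⟩ := exists_contMDiffMap_one_nhds_of_subset_interior
    (n := 1) (modelWithCornersSelf ℝ E) hK.isClosed hKC
  have hχ : ContDiff ℝ 1 χ := χ.contMDiff.contDiff
  obtain ⟨V, hVo, hKV, hV⟩ := mem_nhdsSet_iff_exists.1 hχ1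
  have hCc := hC.isClosed
  have hχ0' : ∀ x ∉ C, fderiv ℝ χ x = 0 := fun x hx => by
    have : χ =ᶠ[𝓝 x] fun _ => (0 : ℝ) :=
      eventually_of_mem (hCc.isOpen_compl.mem_nhds hx) fun y hy => hχ0 y hy
    rw [this.fderiv_eq, fderiv_fun_const]
    rfl
  -- The formula holds even where f is arbitrary: off C both χ and its derivative vanish, and the
  -- product is locally zero.
  have hder : ∀ t ∈ Icc 0 T, ∀ x, HasFDerivAt (fun x => χ x • f t x)
      (χ x • fderiv ℝ (f t) x + (fderiv ℝ χ x).smulRight (f t x)) x := fun t ht x => by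
    by_cases hx : x ∈ C
    · exact ((hχ.differentiable one_ne_zero) x).hasFDerivAt.smul (hfd t ht x (hCU hx)).hasFDerivAt
    · rw [hχ0 x hx, hχ0' x hx, zero_smul, ContinuousLinearMap.zero_smulRight, add_zero]
      have : (fun x => χ x • f t x) =ᶠ[𝓝 x] fun _ => (0 : E) :=
        eventually_of_mem (hCc.isOpen_compl.mem_nhds hx) fun y hy => by
          simp [hχ0 y hy]
      exact (hasFDerivAt_const (0 : E) x).congr_of_eventuallyEq this
  have hcont : ContinuousOn (fun p : ℝ × E => χ p.2 • f p.1 p.2) (Icc 0 T ×ˢ univ) :=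
    continuousOn_prod_univ_of_eq_zero hU hCc hCU
      ((hχ.continuous.comp continuous_snd).continuousOn.smul hf)
      fun t _ x hx => by simp [hχ0 x hx]
  have hD0 : ∀ t ∈ Icc 0 T, ∀ x ∉ C, fderiv ℝ (fun x => χ x • f t x) x = 0 := fun t ht x hx => by
    rw [(hder t ht x).fderiv, hχ0 x hx, hχ0' x hx, zero_smul,
      ContinuousLinearMap.zero_smulRight, add_zero]
  have hDc : ContinuousOn (fun p : ℝ × E => fderiv ℝ (fun x => χ x • f p.1 x) p.2)
      (Icc 0 T ×ˢ univ) := by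
    refine continuousOn_prod_univ_of_eq_zero hU hCc hCU ?_ hD0
    refine ContinuousOn.congr (f := fun p : ℝ × E =>
      χ p.2 • fderiv ℝ (f p.1) p.2 + (fderiv ℝ χ p.2).smulRight (f p.1 p.2)) ?_
      fun p hp => (hder p.1 hp.1 p.2).fderiv
    refine ((hχ.continuous.comp continuous_snd).continuousOn.smul hf').add ?_
    have h1 : ContinuousOn (fun p : ℝ × E => fderiv ℝ χ p.2) (Icc 0 T ×ˢ U) :=
      ((hχ.continuous_fderiv one_ne_zero).comp continuous_snd).continuousOn
    exact ((ContinuousLinearMap.smulRightL ℝ E E).continuous₂).comp_continuousOn (h1.prodMk hf)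
  obtain ⟨L, -, hL⟩ := exists_bound_of_eq_zero hC hDc hD0
  refine ⟨fun t x => χ x • f t x, V ∩ interior C, L, hVo.inter isOpen_interior,
    subset_inter hKV hKC, inter_subset_right.trans (interior_subset.trans hCU), ?_, hcont,
    fun t ht x => (hder t ht x).differentiableAt, hDc, hL, ?_, ?_⟩
  · intro t x hx
    have : χ x = 1 := hV hx.1
    simp [this]
  · intro t ht x y
    exact convex_univ.norm_image_sub_le_of_norm_fderiv_le
      (fun x _ => (hder t ht x).differentiableAt) (fun x _ => hL t ht x) (mem_univ y) (mem_univ x)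
  · intro hf1
    exact contDiffOn_prod_univ_of_eq_zero hU hCc hCU
      ((hχ.comp contDiff_snd).contDiffOn.smul hf1) fun t _ x hx => by simp [hχ0 x hx]

omit [NormedSpace ℝ E] [NormedSpace ℝ Y] in
theorem exists_uniform_near_graph [ProperSpace E] (hG : ContinuousOn G (Icc 0 T ×ˢ univ))
    {z : ℝ → E} (hz : ContinuousOn z (Icc 0 T)) {ε : ℝ} (hε : 0 < ε) :
    ∃ δ, 0 < δ ∧ ∀ t ∈ Icc 0 T, ∀ x, ‖x - z t‖ < δ → ‖G (t, x) - G (t, z t)‖ < ε := by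
  obtain ⟨R, hR⟩ := isCompact_Icc.exists_bound_of_continuousOn hz
  have hu := (isCompact_Icc.prod (isCompact_closedBall (0 : E)
    (R + 1))).uniformContinuousOn_of_continuous (hG.mono (prod_mono_right (subset_univ _)))
  obtain ⟨δ, hδ, h⟩ := Metric.uniformContinuousOn_iff.1 hu ε hε
  -- The bound 1 keeps x in the ball of radius R + 1, where uniform continuity is known.
  refine ⟨min δ 1, lt_min hδ one_pos, fun t ht x hx => ?_⟩
  rw [← dist_eq_norm]
  have h1 := hR t ht
  have hx1 := hx.trans_le (min_le_right _ _)
  refine h (t, x) ⟨ht, ?_⟩ (t, z t) ⟨ht, ?_⟩ ?_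
  · rw [mem_closedBall_zero_iff]
    calc ‖x‖ = ‖z t + (x - z t)‖ := by congr 1; abel
      _ ≤ ‖z t‖ + ‖x - z t‖ := norm_add_le _ _
      _ ≤ R + 1 := by linarith
  · rw [mem_closedBall_zero_iff]
    linarith
  · rw [Prod.dist_eq, dist_self, dist_eq_norm, max_eq_right (norm_nonneg _)]
    exact hx.trans_le (min_le_left _ _)

end

/-! ### Stability and differentiability in the initial value -/

section

variable {X Y : Type*} [NormedAddCommGroup X] [NormedSpace ℝ X] [NormedAddCommGroup Y]
  [NormedSpace ℝ Y] {γ T α β : ℝ}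

theorem ContinuousLinearMap.rlIntegral_comp [CompleteSpace X] [CompleteSpace Y] (ℓ : X →L[ℝ] Y)
    {g : ℝ → X} (hβ : 0 < β) (hγ : 0 < γ) (hg : PowContinuousOn γ T g) {t : ℝ}
    (ht : t ∈ Icc 0 T) : ℓ (rlIntegral β g t) = rlIntegral β (fun s => ℓ (g s)) t := by
  unfold rlIntegral
  rw [map_smul, ← ℓ.intervalIntegral_comp_comm (intervalIntegrable_rpow_smul hβ hγ hg ht)]
  simp only [map_smul]

theorem exists_norm_rlIntegral_le (hβ : 0 < β) (hγ : 0 < γ) (T : ℝ) (X : Type*)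
    [NormedAddCommGroup X] [NormedSpace ℝ X] :
    ∃ K : ℝ, 0 ≤ K ∧ ∀ (r : ℝ → X) (c : ℝ), 0 ≤ c →
      (∀ t ∈ Ioc 0 T, ‖r t‖ ≤ c * t ^ (γ - 1)) →
      ∀ t ∈ Ioc 0 T, ‖rlIntegral β r t‖ ≤ K * c * t ^ (γ - 1) := by
  have hG := Real.Gamma_pos_of_pos hβ
  have hb := beta_pos hγ hβ
  refine ⟨1 / Real.Gamma β * (beta γ β * |T| ^ β), by positivity, fun r c hc hr t ht => ?_⟩
  refine (norm_rlIntegral_le (C := c) hβ hβ hγ ht.1 fun s hs => ?_).trans ?_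
  · have h1 : 0 ≤ (t - s) ^ (β - 1) := Real.rpow_nonneg (by linarith [hs.2]) _
    calc _ ≤ (t - s) ^ (β - 1) * (c * s ^ (γ - 1)) := by
          gcongr
          exact hr s ⟨hs.1, hs.2.le.trans ht.2⟩
      _ = _ := by ring
  · have h1 : t ^ β ≤ |T| ^ β := Real.rpow_le_rpow ht.1.le (ht.2.trans (le_abs_self T)) hβ.le
    have h2 : 0 ≤ t ^ (γ - 1) := Real.rpow_nonneg ht.1.le _
    rw [show γ + β - 1 = β + (γ - 1) by ring, Real.rpow_add ht.1]
    calc _ ≤ 1 / Real.Gamma β * (c * (beta γ β * (|T| ^ β * t ^ (γ - 1)))) := by gcongr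
      _ = _ := by ring

/-- Stability of Volterra equations with respect to the initial value. -/
theorem exists_volterra_stability (hα₀ : 0 < α) (hα₁ : α < 1) (T : ℝ) (X : Type*)
    [NormedAddCommGroup X] [NormedSpace ℝ X] (L : ℝ) :
    ∃ K : ℝ, 0 ≤ K ∧ ∀ (F : ℝ → X → X) (z₁ z₂ : ℝ → X) (U : Set X) (ρ₁ ρ₂ : X),
      IsVolterraSolution α T F U ρ₁ z₁ → IsVolterraSolution α T F U ρ₂ z₂ →
      ContinuousOn (fun t => F t (z₁ t)) (Icc 0 T) →
      ContinuousOn (fun t => F t (z₂ t)) (Icc 0 T) →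
      (∀ t ∈ Icc 0 T, ‖F t (z₁ t) - F t (z₂ t)‖ ≤ L * ‖z₁ t - z₂ t‖) →
      ∀ t ∈ Icc 0 T, ‖z₁ t - z₂ t‖ ≤ K * ‖ρ₁ - ρ₂‖ := by
  obtain ⟨K, hK0, hK⟩ := exists_volterra_gronwall hα₀ hα₁ T X L
  refine ⟨K, hK0, fun F z₁ z₂ U ρ₁ ρ₂ h₁ h₂ hc₁ hc₂ hL => ?_⟩
  refine hK (fun t => z₁ t - z₂ t) (fun t => F t (z₁ t) - F t (z₂ t)) _ (norm_nonneg _)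
    (h₁.continuousOn.sub h₂.continuousOn) hL fun t ht => ?_
  rw [rlIntegral_sub hα₀ one_pos (.of_continuousOn hc₁) (.of_continuousOn hc₂) ht]
  refine le_trans (le_of_eq ?_) (norm_add_le _ _)
  congr 1
  rw [h₁.equation t ht, h₂.equation t ht]
  abel

theorem IsVolterraSolution.eqOn (hα₀ : 0 < α) (hα₁ : α < 1) {F : ℝ → X → X} {z₁ z₂ : ℝ → X}
    {U : Set X} {ρ : X} (h₁ : IsVolterraSolution α T F U ρ z₁)
    (h₂ : IsVolterraSolution α T F U ρ z₂)
    (hc₁ : ContinuousOn (fun t => F t (z₁ t)) (Icc 0 T))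
    (hc₂ : ContinuousOn (fun t => F t (z₂ t)) (Icc 0 T)) {L : ℝ}
    (hL : ∀ t ∈ Icc 0 T, ‖F t (z₁ t) - F t (z₂ t)‖ ≤ L * ‖z₁ t - z₂ t‖) :
    EqOn z₁ z₂ (Icc 0 T) := by
  intro t ht
  obtain ⟨K, -, hK⟩ := exists_volterra_stability hα₀ hα₁ T X L
  have := hK F z₁ z₂ U ρ ρ h₁ h₂ hc₁ hc₂ hL t ht
  rwa [sub_self, norm_zero, mul_zero, norm_le_zero_iff, sub_eq_zero] at this

theorem exists_isVolterraSolution [CompleteSpace X] (hα₀ : 0 < α) (hα₁ : α < 1)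
    {F : ℝ → X → X} {L : ℝ} (hF : ContinuousOn (fun p : ℝ × X => F p.1 p.2) (Icc 0 T ×ˢ univ))
    (hL : ∀ t ∈ Icc 0 T, ∀ x y, ‖F t x - F t y‖ ≤ L * ‖x - y‖) (ρ : X) :
    ∃ z, IsVolterraSolution α T F univ ρ z := by
  have hFo : ContinuousOn (Function.uncurry F) (Ioc 0 T ×ˢ univ) :=
    hF.mono (prod_mono_left Ioc_subset_Icc_self)
  have hLo : ∀ t ∈ Ioc 0 T, ∀ x y, ‖F t x - F t y‖ ≤ L * ‖x - y‖ := fun t ht =>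
    hL t (Ioc_subset_Icc_self ht)
  have hF0 : ∃ C, ∀ t ∈ Ioc 0 T, ‖F t 0‖ ≤ C * t ^ ((1 : ℝ) - 1) :=
    (PowContinuousOn.of_continuousOn (hF.comp (f := fun t : ℝ => (t, (0 : X)))
      (by fun_prop) fun t ht => ⟨ht, mem_univ _⟩)).bound
  obtain ⟨v, hv, heq⟩ := exists_volterra_solution (γ := 1) (T := T) hα₀ hα₁ one_pos
    (g := fun _ => ρ) (.of_continuousOn continuousOn_const) hFo hLo hF0
  have hFv := hv.lipschitz_comp hFo hLo hF0
  -- The fixed point v is controlled only on (0,T]. The right-hand side agrees with it there and has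
  -- the correct value ρ at 0.
  refine ⟨fun t => ρ + rlIntegral α (fun s => F s (v s)) t, ?_, fun t _ => mem_univ _,
    fun t ht => ?_⟩
  · exact continuousOn_const.add
      ((hFv.rlIntegral hα₀ one_pos).continuousOn_Icc (by linarith) rlIntegral_zero_right)
  · congr 1
    refine rlIntegral_congr ht.1 fun s hs => ?_
    rw [← heq s ⟨hs.1, hs.2.le.trans ht.2⟩]

omit [NormedSpace ℝ X] [NormedSpace ℝ Y] in
theorem continuousOn_field_comp {F : ℝ → X → Y} {U : Set X}
    (hF : ContinuousOn (fun p : ℝ × X => F p.1 p.2) (Icc 0 T ×ˢ U)) {z : ℝ → X}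
    (hz : ContinuousOn z (Icc 0 T)) (hzU : ∀ t ∈ Icc 0 T, z t ∈ U) :
    ContinuousOn (fun t => F t (z t)) (Icc 0 T) :=
  hF.comp (continuousOn_id.prodMk hz) fun t ht => ⟨ht, hzU t ht⟩

theorem continuousOn_variationalField {F : ℝ → X → X} {U : Set X}
    (hF' : ContinuousOn (fun p : ℝ × X => fderiv ℝ (F p.1) p.2) (Icc 0 T ×ˢ U)) {z : ℝ → X}
    (hz : ContinuousOn z (Icc 0 T)) (hzU : ∀ t ∈ Icc 0 T, z t ∈ U) :
    ContinuousOn (fun p : ℝ × (X →L[ℝ] X) => variationalField F z p.1 p.2)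
      (Icc 0 T ×ˢ univ) := by
  have h1 : ContinuousOn (fun p : ℝ × (X →L[ℝ] X) => fderiv ℝ (F p.1) (z p.1))
      (Icc 0 T ×ˢ univ) :=
    (continuousOn_field_comp (F := fun t x => fderiv ℝ (F t) x) hF' hz hzU).comp
      continuousOn_fst fun p hp => hp.1
  exact h1.clm_comp continuousOn_snd

theorem norm_variationalField_sub_le {F : ℝ → X → X} {z : ℝ → X} {L t : ℝ}
    (hL : ‖fderiv ℝ (F t) (z t)‖ ≤ L) (Ψ₁ Ψ₂ : X →L[ℝ] X) :
    ‖variationalField F z t Ψ₁ - variationalField F z t Ψ₂‖ ≤ L * ‖Ψ₁ - Ψ₂‖ := by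
  rw [variationalField, variationalField, ← ContinuousLinearMap.comp_sub]
  exact (ContinuousLinearMap.opNorm_comp_le _ _).trans (by gcongr)

/-- Solutions of a Volterra equation are differentiable with respect to the initial value, and the
derivative solves the variational equation. -/
theorem hasFDerivAt_volterra [ProperSpace X] [CompleteSpace X] (hα₀ : 0 < α) (hα₁ : α < 1)
    {F : ℝ → X → X} {L : ℝ}
    (hF : ContinuousOn (fun p : ℝ × X => F p.1 p.2) (Icc 0 T ×ˢ univ))
    (hFd : ∀ t ∈ Icc 0 T, Differentiable ℝ (F t))
    (hF' : ContinuousOn (fun p : ℝ × X => fderiv ℝ (F p.1) p.2) (Icc 0 T ×ˢ univ))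
    (hL' : ∀ t ∈ Icc 0 T, ∀ x, ‖fderiv ℝ (F t) x‖ ≤ L)
    (hL : ∀ t ∈ Icc 0 T, ∀ x y, ‖F t x - F t y‖ ≤ L * ‖x - y‖)
    {z : X → ℝ → X} {ρ₀ : X} (hz₀ : IsVolterraSolution α T F univ ρ₀ (z ρ₀))
    (hz : ∀ᶠ ρ in 𝓝 ρ₀, IsVolterraSolution α T F univ ρ (z ρ))
    {Φ : ℝ → X →L[ℝ] X}
    (hΦ : IsVolterraSolution α T (variationalField F (z ρ₀)) univ (ContinuousLinearMap.id ℝ X) Φ) :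
    ∀ t ∈ Icc 0 T, HasFDerivAt (fun ρ => z ρ t) (Φ t) ρ₀ := by
  intro t ht
  obtain ⟨K₁, hK₁0, hK₁⟩ := exists_volterra_stability hα₀ hα₁ T X L
  obtain ⟨K₂, hK₂0, hK₂⟩ := exists_volterra_gronwall hα₀ hα₁ T X L
  obtain ⟨K₃, hK₃0, hK₃⟩ := exists_norm_rlIntegral_le hα₀ one_pos T X
  refine .of_isLittleO (Asymptotics.isLittleO_iff.2 fun c hc => ?_)
  -- The three constants are those of stability, Grönwall and the bound on I^α; adding 1 keeps the
  -- denominator positive.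
  set ε : ℝ := c / (K₂ * K₃ * K₁ + 1) with hε
  have hden : 0 < K₂ * K₃ * K₁ + 1 := by positivity
  have hε0 : 0 < ε := div_pos hc hden
  obtain ⟨δ, hδ, hδε⟩ := exists_uniform_near_graph hF' hz₀.continuousOn hε0
  have hball : ∀ᶠ ρ in 𝓝 ρ₀, K₁ * ‖ρ - ρ₀‖ < δ := by
    have : ContinuousAt (fun ρ => K₁ * ‖ρ - ρ₀‖) ρ₀ := by fun_prop
    refine this.eventually_lt_const ?_
    simpa using hδ
  filter_upwards [hz, hball] with ρ hρ hρδ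
  have hFz : ContinuousOn (fun s => F s (z ρ s)) (Icc 0 T) :=
    continuousOn_field_comp hF hρ.continuousOn fun _ _ => mem_univ _
  have hFz₀ : ContinuousOn (fun s => F s (z ρ₀ s)) (Icc 0 T) :=
    continuousOn_field_comp hF hz₀.continuousOn fun _ _ => mem_univ _
  have hA : ContinuousOn (fun s => fderiv ℝ (F s) (z ρ₀ s)) (Icc 0 T) :=
    continuousOn_field_comp (F := fun t x => fderiv ℝ (F t) x) hF' hz₀.continuousOn
      fun _ _ => mem_univ _
  have hstab : ∀ s ∈ Icc 0 T, ‖z ρ s - z ρ₀ s‖ ≤ K₁ * ‖ρ - ρ₀‖ :=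
    hK₁ F _ _ _ _ _ hρ hz₀ hFz hFz₀ fun s hs => hL s hs _ _
  -- With r the Taylor remainder of F, the error satisfies e = I^α r + I^α(F' e), to which Grönwall
  -- applies.
  set e : ℝ → X := fun s => z ρ s - z ρ₀ s - Φ s (ρ - ρ₀) with he
  set r : ℝ → X := fun s => F s (z ρ s) - F s (z ρ₀ s) -
    fderiv ℝ (F s) (z ρ₀ s) (z ρ s - z ρ₀ s) with hr
  set w : ℝ → X := fun s => fderiv ℝ (F s) (z ρ₀ s) (e s) with hw
  have hec : ContinuousOn e (Icc 0 T) :=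
    (hρ.continuousOn.sub hz₀.continuousOn).sub (hΦ.continuousOn.clm_apply continuousOn_const)
  have hrc : ContinuousOn r (Icc 0 T) :=
    (hFz.sub hFz₀).sub (hA.clm_apply (hρ.continuousOn.sub hz₀.continuousOn))
  have hwc : ContinuousOn w (Icc 0 T) := hA.clm_apply hec
  have hrb : ∀ s ∈ Ioc 0 T, ‖r s‖ ≤ ε * (K₁ * ‖ρ - ρ₀‖) * s ^ ((1 : ℝ) - 1) := fun s hs => by
    have hs' := Ioc_subset_Icc_self hs
    rw [sub_self, Real.rpow_zero, mul_one]
    -- Mean value inequality on the ball where the Jacobian varies by less than ε; stability places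
    -- z ρ s in it.
    have h1 := (convex_ball (z ρ₀ s) δ).norm_image_sub_le_of_norm_fderiv_le' (f := F s)
      (φ := fderiv ℝ (F s) (z ρ₀ s)) (C := ε) (fun x _ => hFd s hs' x)
      (fun x hx => (hδε s hs' x (by rwa [← dist_eq_norm])).le)
      (Metric.mem_ball_self hδ) (y := z ρ s)
      (by rw [Metric.mem_ball, dist_eq_norm]; exact (hstab s hs').trans_lt hρδ)
    exact h1.trans (by gcongr; exact hstab s hs')
  have heq : ∀ s ∈ Icc 0 T, e s = rlIntegral α r s + rlIntegral α w s := fun s hs => by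
    have h1 : Φ s (ρ - ρ₀) = (ρ - ρ₀) +
        rlIntegral α (fun x => fderiv ℝ (F x) (z ρ₀ x) (Φ x (ρ - ρ₀))) s := by
      -- Evaluation at ρ - ρ₀ is continuous and linear, so it passes through the integral in the
      -- equation for Φ.
      have h2 := (ContinuousLinearMap.apply ℝ X (ρ - ρ₀)).rlIntegral_comp hα₀ one_pos
        (.of_continuousOn (hA.clm_comp hΦ.continuousOn)) hs
      have h3 := congrArg (fun ψ : X →L[ℝ] X => ψ (ρ - ρ₀)) (hΦ.equation s hs)
      simp only [add_apply, ContinuousLinearMap.id_apply] at h3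
      rw [h3]
      congr 1
    rw [← rlIntegral_add hα₀ one_pos (.of_continuousOn hrc) (.of_continuousOn hwc) hs]
    have h4 : rlIntegral α (fun x => r x + w x) s = rlIntegral α (fun x => F x (z ρ x) -
        F x (z ρ₀ x) - fderiv ℝ (F x) (z ρ₀ x) (Φ x (ρ - ρ₀))) s := by
      congr 1
      funext x
      simp only [hr, hw, he, map_sub]
      abel
    rw [h4, rlIntegral_sub hα₀ one_pos
      ((PowContinuousOn.of_continuousOn hFz).sub (.of_continuousOn hFz₀)) (.of_continuousOn
      (hA.clm_apply (hΦ.continuousOn.clm_apply continuousOn_const))) hs,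
      rlIntegral_sub hα₀ one_pos (.of_continuousOn hFz) (.of_continuousOn hFz₀) hs]
    simp only [he]
    rw [h1, hρ.equation s hs, hz₀.equation s hs]
    abel
  have hfin := hK₂ e w (K₃ * (ε * (K₁ * ‖ρ - ρ₀‖))) (by positivity) hec
    (fun s hs => ((fderiv ℝ (F s) (z ρ₀ s)).le_opNorm _).trans (by
      have := hL' s hs (z ρ₀ s)
      gcongr))
    (fun s hs => by
      rcases hs.1.eq_or_lt with rfl | hs0
      · rw [heq 0 hs, rlIntegral_zero_right, rlIntegral_zero_right, add_zero, norm_zero]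
        positivity
      · rw [heq s hs]
        refine (norm_add_le _ _).trans ?_
        gcongr
        have := hK₃ r _ (by positivity) hrb s ⟨hs0, hs.2⟩
        simpa using this) t ht
  refine hfin.trans ?_
  calc K₂ * (K₃ * (ε * (K₁ * ‖ρ - ρ₀‖))) = (K₂ * K₃ * K₁) * ε * ‖ρ - ρ₀‖ := by ring
    _ ≤ (K₂ * K₃ * K₁ + 1) * ε * ‖ρ - ρ₀‖ := by gcongr; linarith
    _ = c * ‖ρ - ρ₀‖ := by rw [hε, mul_div_cancel₀ _ hden.ne']

end

/-! ### Regularity in time and the classical Caputo formula -/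

section

variable {X : Type*} [NormedAddCommGroup X] [NormedSpace ℝ X] {T α : ℝ}

theorem uniqueDiffOn_Icc_prod (hT : 0 < T) {U : Set X} (hU : IsOpen U) :
    UniqueDiffOn ℝ (Icc 0 T ×ˢ U) :=
  (uniqueDiffOn_Icc hT).prod hU.uniqueDiffOn

/-- The spatial derivative of a time-dependent field is the restriction of its total derivative. -/
theorem hasFDerivAt_slice {Y : Type*} [NormedAddCommGroup Y] [NormedSpace ℝ Y] {U : Set X}
    (hU : IsOpen U) {f : ℝ → X → Y}
    (hf : DifferentiableOn ℝ (fun p : ℝ × X => f p.1 p.2) (Icc 0 T ×ˢ U)) {t : ℝ}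
    (ht : t ∈ Icc 0 T) {x : X} (hx : x ∈ U) :
    HasFDerivAt (f t) ((fderivWithin ℝ (fun p : ℝ × X => f p.1 p.2) (Icc 0 T ×ˢ U) (t, x)).comp
      (ContinuousLinearMap.inr ℝ ℝ X)) x := by
  have h1 := (hf (t, x) ⟨ht, hx⟩).hasFDerivWithinAt
  have h2 : HasFDerivWithinAt (fun x : X => (t, x)) (ContinuousLinearMap.inr ℝ ℝ X) U x :=
    (hasFDerivAt_prodMk_right t x).hasFDerivWithinAt
  exact (h1.comp x h2 fun y hy => ⟨ht, hy⟩).hasFDerivAt (hU.mem_nhds hx)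

theorem continuousOn_fderiv_slice (hT : 0 < T) {U : Set X} (hU : IsOpen U) {f : ℝ → X → X}
    (hf : ContDiffOn ℝ 1 (fun p : ℝ × X => f p.1 p.2) (Icc 0 T ×ˢ U)) :
    ContinuousOn (fun p : ℝ × X => fderiv ℝ (f p.1) p.2) (Icc 0 T ×ˢ U) := by
  have h1 := hf.continuousOn_fderivWithin (uniqueDiffOn_Icc_prod hT hU) le_rfl
  exact (h1.clm_comp continuousOn_const).congr fun p hp =>
    (hasFDerivAt_slice hU (hf.differentiableOn one_ne_zero) hp.1 hp.2).fderiv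

theorem contDiffOn_fderiv_slice (hT : 0 < T) {U : Set X} (hU : IsOpen U) {f : ℝ → X → X}
    (hf : ContDiffOn ℝ 2 (fun p : ℝ × X => f p.1 p.2) (Icc 0 T ×ˢ U)) :
    ContDiffOn ℝ 1 (fun p : ℝ × X => fderiv ℝ (f p.1) p.2) (Icc 0 T ×ˢ U) := by
  have h1 := hf.fderivWithin (m := 1) (uniqueDiffOn_Icc_prod hT hU) (by norm_num)
  exact (h1.clm_comp contDiffOn_const).congr fun p hp =>
    (hasFDerivAt_slice hU (hf.differentiableOn two_ne_zero) hp.1 hp.2).fderiv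

theorem powContinuousOn_rpow_smul (c : X) :
    PowContinuousOn α T (fun t => (t ^ (α - 1) / Real.Gamma α) • c) := by
  refine ⟨((ContinuousOn.rpow_const continuousOn_id fun t ht =>
    Or.inl ht.1.ne').div_const _).smul continuousOn_const, ‖c‖ / |Real.Gamma α|, fun t ht => ?_⟩
  rw [norm_smul, norm_div, Real.norm_of_nonneg (Real.rpow_nonneg ht.1.le _), Real.norm_eq_abs]
  exact le_of_eq (by ring)

theorem rlIntegral_const [CompleteSpace X] (c : X) (t : ℝ) :
    rlIntegral α (fun _ => c) t = ∫ s in (0 : ℝ)..t, (s ^ (α - 1) / Real.Gamma α) • c := by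
  rw [rlIntegral, intervalIntegral.integral_smul_const, intervalIntegral.integral_smul_const,
    intervalIntegral.integral_div, smul_smul]
  have := intervalIntegral.integral_comp_sub_left (a := 0) (b := t) (fun x => x ^ (α - 1)) t
  rw [sub_self, sub_zero] at this
  rw [this]
  congr 1
  ring

section Regularity

variable {F : ℝ → X → X}

/-- The total derivative of a time-dependent vector field on `[0,T]`. -/
noncomputable def totalDeriv (T : ℝ) (F : ℝ → X → X) : ℝ × X → ℝ × X →L[ℝ] X :=
  fderivWithin ℝ (fun p : ℝ × X => F p.1 p.2) (Icc 0 T ×ˢ univ)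

theorem continuousOn_totalDeriv (hT : 0 < T)
    (hF : ContDiffOn ℝ 1 (fun p : ℝ × X => F p.1 p.2) (Icc 0 T ×ˢ univ)) :
    ContinuousOn (totalDeriv T F) (Icc 0 T ×ˢ univ) :=
  hF.continuousOn_fderivWithin (uniqueDiffOn_Icc_prod hT isOpen_univ) le_rfl

theorem powContinuousOn_fderivWithin_apply (hT : 0 < T) (hα₁ : α ≤ 1)
    (hF : ContDiffOn ℝ 1 (fun p : ℝ × X => F p.1 p.2) (Icc 0 T ×ˢ univ)) {z v : ℝ → X}
    (hz : ContinuousOn z (Icc 0 T)) (hv : PowContinuousOn α T v) :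
    PowContinuousOn α T (fun s => totalDeriv T F (s, z s) (1, v s)) := by
  have hD := continuousOn_totalDeriv hT hF
  have hDz : ContinuousOn (fun s => totalDeriv T F (s, z s)) (Icc 0 T) :=
    hD.comp (continuousOn_id.prodMk hz) fun t ht => ⟨ht, mem_univ _⟩
  obtain ⟨M, hM⟩ := isCompact_Icc.exists_bound_of_continuousOn hDz
  have h1 : PowContinuousOn α T (fun _ => (1 : ℝ)) :=
    (PowContinuousOn.of_continuousOn continuousOn_const).mono hα₁
  obtain ⟨C₁, hC₁⟩ := h1.bound
  obtain ⟨C, hC⟩ := hv.bound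
  refine ⟨(hDz.mono Ioc_subset_Icc_self).clm_apply (continuousOn_const.prodMk hv.continuousOn),
    M * (C₁ + C), fun t ht => ?_⟩
  have h2 : ‖((1 : ℝ), v t)‖ ≤ C₁ * t ^ (α - 1) + C * t ^ (α - 1) :=
    (norm_prod_le_iff.2 ⟨le_add_of_nonneg_right (norm_nonneg _),
      le_add_of_nonneg_left (norm_nonneg _)⟩).trans (add_le_add (hC₁ t ht) (hC t ht))
  have h3 := hM t (Ioc_subset_Icc_self ht)
  calc _ ≤ ‖totalDeriv T F (t, z t)‖ * ‖((1 : ℝ), v t)‖ := ContinuousLinearMap.le_opNorm _ _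
    _ ≤ M * (C₁ * t ^ (α - 1) + C * t ^ (α - 1)) := by gcongr; exact (norm_nonneg _).trans h3
    _ = _ := by ring

/-- One step of the Picard iteration, together with its differentiated version. -/
theorem picard_step_eq_integral [CompleteSpace X] (hT : 0 < T) (hα₀ : 0 < α) (hα₁ : α < 1)
    (hF : ContDiffOn ℝ 1 (fun p : ℝ × X => F p.1 p.2) (Icc 0 T ×ˢ univ)) {z v : ℝ → X} {ρ : X}
    (hz : ContinuousOn z (Icc 0 T)) (hv : PowContinuousOn α T v)
    (hzv : ∀ t ∈ Icc 0 T, z t = ρ + ∫ s in (0 : ℝ)..t, v s) {t : ℝ} (ht : t ∈ Icc 0 T) :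
    ρ + rlIntegral α (fun s => F s (z s)) t = ρ + ∫ s in (0 : ℝ)..t,
      ((s ^ (α - 1) / Real.Gamma α) • F 0 ρ + rlIntegral α (fun x => totalDeriv T F (x, z x) (1, v x)) s) := by
  have hz0 : z 0 = ρ := by simpa using hzv 0 ⟨le_rfl, hT.le⟩
  have hP := powContinuousOn_fderivWithin_apply hT hα₁.le hF hz hv
  have hh : ContinuousOn (fun s => F s (z s)) (Icc 0 T) :=
    continuousOn_field_comp hF.continuousOn hz fun _ _ => mem_univ _
  have hder : ∀ s ∈ Ioo 0 T, HasDerivAt (fun s => F s (z s)) (totalDeriv T F (s, z s) (1, v s)) s := by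
    intro s hs
    have hs' := Ioo_subset_Icc_self hs
    have hn := Icc_mem_nhds hs.1 hs.2
    have h1 : HasDerivAt z (v s) s :=
      ((((hasDerivWithinAt_integral_Icc hα₀ hv hs' (hv.continuousWithinAt ⟨hs.1, hs.2.le⟩)).const_add
        ρ).congr hzv (hzv s hs')).hasDerivAt hn)
    have h2 := ((hF.differentiableOn one_ne_zero) (s, z s)
      ⟨hs', mem_univ _⟩).hasFDerivWithinAt.hasFDerivAt (prod_mem_nhds hn univ_mem)
    exact h2.comp_hasDerivAt s ((hasDerivAt_id s).prodMk h1)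
  -- Along z the field is F(0,ρ) plus I^1 of its derivative. Since I^α I^1 = I^1 I^α, the derivative
  -- may be taken under I^α, and the constant produces the singular term s^(α-1).
  have hint : ∀ s ∈ Icc 0 T, F s (z s) = F 0 ρ + rlIntegral 1 (fun x => totalDeriv T F (x, z x) (1, v x)) s :=
    fun s hs => by
      rw [rlIntegral_one_eq, eq_add_integral_of_hasDerivAt hα₀ hP hh hder hs, hz0]
  congr 1
  rw [intervalIntegral.integral_add ((powContinuousOn_rpow_smul _).intervalIntegrable hα₀ ht)
    ((hP.rlIntegral hα₀ hα₀).intervalIntegrable (by linarith) ht), ← rlIntegral_const,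
    ← rlIntegral_one_eq, rlIntegral_rlIntegral hα₀ one_pos hα₀ hP ht, add_comm 1 α,
    ← rlIntegral_rlIntegral one_pos hα₀ hα₀ hP ht, ← rlIntegral_add hα₀ one_pos
    (.of_continuousOn continuousOn_const) ((hP.rlIntegral one_pos hα₀).mono (by linarith)) ht]
  exact rlIntegral_congr ht.1 fun s hs => hint s ⟨hs.1.le, hs.2.le.trans ht.2⟩

/-- Solutions of Volterra equations with a globally Lipschitz `C¹` right-hand side are primitives
of functions that are continuous on `(0,T]` and of order `t^(α-1)`. -/
theorem exists_eq_integral_of_lipschitz [CompleteSpace X] [ProperSpace X] (hT : 0 < T)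
    (hα₀ : 0 < α) (hα₁ : α < 1)
    (hF : ContDiffOn ℝ 1 (fun p : ℝ × X => F p.1 p.2) (Icc 0 T ×ˢ univ)) {L : ℝ}
    (hL' : ∀ t ∈ Icc 0 T, ∀ x, ‖fderiv ℝ (F t) x‖ ≤ L)
    (hL : ∀ t ∈ Icc 0 T, ∀ x y, ‖F t x - F t y‖ ≤ L * ‖x - y‖) {z : ℝ → X} {ρ : X}
    (hz : IsVolterraSolution α T F univ ρ z) :
    ∃ v, PowContinuousOn α T v ∧ ∀ t ∈ Icc 0 T, z t = ρ + ∫ s in (0 : ℝ)..t, v s := by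
  have hD := continuousOn_totalDeriv hT hF
  have hDL : ∀ t ∈ Icc 0 T, ∀ x w, ‖totalDeriv T F (t, x) (0, w)‖ ≤ L * ‖w‖ := fun t ht x w => by
    have h1 := (hasFDerivAt_slice isOpen_univ (hF.differentiableOn one_ne_zero) ht
      (mem_univ x)).fderiv
    have h2 := (fderiv ℝ (F t) x).le_of_opNorm_le (hL' t ht x) w
    rw [h1] at h2
    simpa [totalDeriv] using h2
  have hDz : ContinuousOn (fun s => totalDeriv T F (s, z s)) (Icc 0 T) :=
    hD.comp (continuousOn_id.prodMk hz.continuousOn) fun t ht => ⟨ht, mem_univ _⟩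
  set g : ℝ → X := fun t => (t ^ (α - 1) / Real.Gamma α) • F 0 ρ with hg
  have hgP : PowContinuousOn α T g := powContinuousOn_rpow_smul _
  have hsplit : ∀ (A : ℝ × X →L[ℝ] X) (x y : X), A (1, x) - A (1, y) = A (0, x - y) :=
    fun A x y => by rw [← map_sub, Prod.mk_sub_mk, sub_self]
  -- The candidate derivative v solves the formally differentiated equation, which is affine in v
  -- once z is known.
  obtain ⟨v, hv, hveq⟩ := exists_volterra_solution (γ := α) (T := T) hα₀ hα₁ hα₀
    (F := fun s x => totalDeriv T F (s, z s) (1, x)) (L := L) hgP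
    (by
      have h1 : ContinuousOn (fun p : ℝ × X => totalDeriv T F (p.1, z p.1)) (Ioc 0 T ×ˢ univ) :=
        (hDz.mono Ioc_subset_Icc_self).comp continuousOn_fst fun p hp => hp.1
      exact h1.clm_apply (continuousOn_const.prodMk continuousOn_snd))
    (fun t ht x y => by
      rw [hsplit]
      exact hDL t (Ioc_subset_Icc_self ht) _ _)
    ((PowContinuousOn.of_continuousOn (hDz.clm_apply
      (continuousOn_const (c := ((1 : ℝ), (0 : X)))))).mono hα₁.le).bound
  refine ⟨v, hv, ?_⟩
  -- Picard iterates paired with their derivatives, started from the constant ρ and 0; each first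
  -- component is ρ plus the primitive of the second.
  let p : ℕ → (ℝ → X) × (ℝ → X) := fun n => n.rec (fun _ => ρ, fun _ => 0) fun _ q =>
    (fun t => ρ + rlIntegral α (fun s => F s (q.1 s)) t,
      fun t => g t + rlIntegral α (fun s => totalDeriv T F (s, q.1 s) (1, q.2 s)) t)
  have hp1 : ∀ n t, (p (n + 1)).1 t = ρ + rlIntegral α (fun s => F s ((p n).1 s)) t :=
    fun n t => rfl
  have hp2 : ∀ n t, (p (n + 1)).2 t =
      g t + rlIntegral α (fun s => totalDeriv T F (s, (p n).1 s) (1, (p n).2 s)) t := fun n t => rfl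
  have hinv : ∀ n, ContinuousOn (p n).1 (Icc 0 T) ∧ PowContinuousOn α T (p n).2 ∧
      ∀ t ∈ Icc 0 T, (p n).1 t = ρ + ∫ s in (0 : ℝ)..t, (p n).2 s := by
    intro n
    induction n with
    | zero =>
      refine ⟨continuousOn_const, ⟨continuousOn_const, 0, by simp [p]⟩, by simp [p]⟩
    | succ n ih =>
      obtain ⟨h1, h2, h3⟩ := ih
      refine ⟨?_, ?_, fun t ht => picard_step_eq_integral hT hα₀ hα₁ hF h1 h2 h3 ht⟩
      · have hFc := continuousOn_field_comp hF.continuousOn h1 fun _ _ => mem_univ _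
        exact continuousOn_const.add (((PowContinuousOn.of_continuousOn hFc).rlIntegral hα₀
          one_pos).continuousOn_Icc (by linarith) rlIntegral_zero_right)
      · exact hgP.add (((powContinuousOn_fderivWithin_apply hT hα₁.le hF h1 h2).rlIntegral hα₀
          hα₀).mono (by linarith))
  have hFz := continuousOn_field_comp hF.continuousOn hz.continuousOn fun _ _ => mem_univ _
  have hFp : ∀ n, ContinuousOn (fun s => F s ((p n).1 s)) (Icc 0 T) := fun n =>
    continuousOn_field_comp hF.continuousOn (hinv n).1 fun _ _ => mem_univ _
  have hz0 : z 0 = ρ := by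
    rw [hz.equation 0 ⟨le_rfl, hT.le⟩, rlIntegral_zero_right, add_zero]
  have hp0 : ∀ n, (p n).1 0 = ρ := fun n => by simpa using (hinv n).2.2 0 ⟨le_rfl, hT.le⟩
  have hzlim : ∀ ε > 0, ∃ N, ∀ n ≥ N, ∀ t ∈ Icc 0 T, ‖(p n).1 t - z t‖ < ε := by
    obtain ⟨K, hK1, hK⟩ := exists_volterra_recursion_bound hα₀ hα₁ one_pos T X L
    obtain ⟨B, hB0, hB⟩ := (PowContinuousOn.of_continuousOn
      ((hinv 0).1.sub hz.continuousOn)).exists_nonneg_bound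
    have h1 := hK (fun n t => (p n).1 t - z t) (fun n t => F t ((p n).1 t) - F t (z t)) 0 B le_rfl
      hB0 hB (fun n t ht => hL t (Ioc_subset_Icc_self ht) _ _) fun n t ht => by
        have ht' := Ioc_subset_Icc_self ht
        rw [rlIntegral_sub hα₀ one_pos (.of_continuousOn (hFp n)) (.of_continuousOn hFz) ht', hp1,
          hz.equation t ht', add_sub_add_left_eq_sub, zero_mul, zero_add]
    intro ε hε
    have hlim : Tendsto (fun n : ℕ => B / (2 : ℝ) ^ n * K) atTop (𝓝 0) := by
      have h2 := ((tendsto_pow_atTop_nhds_zero_of_lt_one (r := (2 : ℝ)⁻¹) (by norm_num)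
        (by norm_num)).const_mul B).mul_const K
      simpa only [div_eq_mul_inv, ← inv_pow, mul_zero, zero_mul] using h2
    obtain ⟨N, hN⟩ := eventually_atTop.1 (hlim.eventually_lt_const hε)
    refine ⟨N, fun n hn t ht => ?_⟩
    rcases ht.1.eq_or_lt with rfl | ht0
    · rw [hp0, hz0, sub_self, norm_zero]
      exact hε
    · have h3 := h1 n t ⟨ht0, ht.2⟩
      simp only [mul_zero, zero_add, sub_self, Real.rpow_zero, mul_one] at h3
      exact h3.trans_lt (hN n hn)
  have hvlim : ∀ η > 0, ∃ N, ∀ n ≥ N, ∀ t ∈ Ioc 0 T,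
      ‖(p n).2 t - v t‖ ≤ η * t ^ (α - 1) := by
    intro η hη
    obtain ⟨K, hK1, hK⟩ := exists_volterra_recursion_bound hα₀ hα₁ hα₀ T X L
    obtain ⟨K₃, hK₃0, hK₃⟩ := exists_norm_rlIntegral_le hα₀ hα₀ T X
    have hv1 : PowContinuousOn α T (fun s => ((1 : ℝ), v s)) := by
      have h1 : PowContinuousOn α T (fun _ => (1 : ℝ)) :=
        (PowContinuousOn.of_continuousOn continuousOn_const).mono hα₁.le
      obtain ⟨C₁, hC₁⟩ := h1.bound
      obtain ⟨C, hC⟩ := hv.bound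
      refine ⟨continuousOn_const.prodMk hv.continuousOn, max C₁ C, fun t ht => ?_⟩
      have := Real.rpow_nonneg ht.1.le (α - 1)
      exact norm_prod_le_iff.2 ⟨(hC₁ t ht).trans (by gcongr; exact le_max_left _ _),
        (hC t ht).trans (by gcongr; exact le_max_right _ _)⟩
    obtain ⟨C₁, hC₁0, hC₁⟩ := hv1.exists_nonneg_bound
    have hden : 0 < 4 * K * (K₃ * C₁ + 1) := by positivity
    -- Chosen so that the source contribution 2 K₃ ε C₁ K is at most η/2; the other half absorbs the
    -- geometric term.
    set ε := η / (4 * K * (K₃ * C₁ + 1)) with hε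
    have hε0 : 0 < ε := div_pos hη hden
    obtain ⟨δ, hδ, hδε⟩ := exists_uniform_near_graph hD hz.continuousOn hε0
    obtain ⟨N, hN⟩ := hzlim δ hδ
    obtain ⟨B, hB0, hB⟩ := ((hinv N).2.1.sub hv).exists_nonneg_bound
    have hDp : ∀ n, ContinuousOn (fun s => totalDeriv T F (s, (p n).1 s)) (Icc 0 T) := fun n =>
      hD.comp (continuousOn_id.prodMk (hinv n).1) fun t ht => ⟨ht, mem_univ _⟩
    -- From index N on, the coefficient along the iterate is ε-close to the one along z. Replacing
    -- one by the other costs a small source term, and the remaining difference is Lipschitz in the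
    -- derivatives.
    have h1 := hK (fun m t => (p (N + m)).2 t - v t)
      (fun m t => totalDeriv T F (t, (p (N + m)).1 t) (1, (p (N + m)).2 t) - totalDeriv T F (t, (p (N + m)).1 t) (1, v t))
      (K₃ * (ε * C₁)) B (by positivity) hB0 hB
      (fun m t ht => by
        rw [hsplit]
        exact hDL t (Ioc_subset_Icc_self ht) _ _)
      fun m t ht => by
        have ht' := Ioc_subset_Icc_self ht
        have hP1 := powContinuousOn_fderivWithin_apply hT hα₁.le hF (hinv (N + m)).1
          (hinv (N + m)).2.1
        have hP2 := powContinuousOn_fderivWithin_apply hT hα₁.le hF (hinv (N + m)).1 hv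
        have hP3 := powContinuousOn_fderivWithin_apply hT hα₁.le hF hz.continuousOn hv
        have hr := hK₃ (fun s => totalDeriv T F (s, (p (N + m)).1 s) (1, v s) - totalDeriv T F (s, z s) (1, v s)) (ε * C₁)
          (by positivity) (fun s hs => by
            rw [← sub_apply]
            have hs' := Ioc_subset_Icc_self hs
            have h2 := (hδε s hs' _ (hN (N + m) (by omega) s hs')).le
            calc _ ≤ ‖totalDeriv T F (s, (p (N + m)).1 s) - totalDeriv T F (s, z s)‖ * ‖((1 : ℝ), v s)‖ :=
                  ContinuousLinearMap.le_opNorm _ _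
              _ ≤ ε * (C₁ * s ^ (α - 1)) := by gcongr; exact hC₁ s hs
              _ = _ := by ring) t ht
        refine le_trans (le_of_eq ?_) ((norm_add_le _ _).trans (add_le_add_left hr _))
        congr 1
        rw [rlIntegral_sub hα₀ hα₀ hP2 hP3 ht', rlIntegral_sub hα₀ hα₀ hP1 hP2 ht', hveq t ht,
          ← add_assoc, hp2]
        abel
    have hlim : Tendsto (fun n : ℕ => B / (2 : ℝ) ^ n * K) atTop (𝓝 0) := by
      have h2 := ((tendsto_pow_atTop_nhds_zero_of_lt_one (r := (2 : ℝ)⁻¹) (by norm_num)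
        (by norm_num)).const_mul B).mul_const K
      simpa only [div_eq_mul_inv, ← inv_pow, mul_zero, zero_mul] using h2
    obtain ⟨m₀, hm₀⟩ := eventually_atTop.1 (hlim.eventually_lt_const (half_pos hη))
    refine ⟨N + m₀, fun n hn t ht => ?_⟩
    obtain ⟨m, rfl⟩ : ∃ m, n = N + m := ⟨n - N, by omega⟩
    have h3 := h1 m t ht
    have h4 := hm₀ m (by omega)
    have h5 : 2 * (K₃ * (ε * C₁)) * K ≤ η / 2 := by
      have h6 : η = ε * (4 * K * (K₃ * C₁ + 1)) := by rw [hε, div_mul_cancel₀ _ hden.ne']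
      rw [h6]
      have : 0 ≤ ε * K := by positivity
      nlinarith
    have := Real.rpow_nonneg ht.1.le (α - 1)
    refine h3.trans ?_
    gcongr
    rw [add_mul]
    linarith
  intro t ht
  rcases ht.1.eq_or_lt with rfl | ht0
  · simp [hz0]
  -- The iterates tend to z(t), while as primitives they tend to ρ plus the integral of v by the
  -- weighted convergence.
  refine tendsto_nhds_unique (f := fun n => (p n).1 t) (l := atTop) ?_ ?_
  · rw [Metric.tendsto_atTop]
    intro ε hε
    obtain ⟨N, hN⟩ := hzlim ε hε
    exact ⟨N, fun n hn => by rw [dist_eq_norm]; exact hN n hn t ht⟩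
  · rw [Metric.tendsto_atTop]
    intro ε hε
    obtain ⟨K, hK0, hK⟩ := exists_norm_rlIntegral_le one_pos hα₀ T X
    have htp := Real.rpow_pos_of_pos ht0 (α - 1)
    have hden : 0 < (K + 1) * t ^ (α - 1) := by positivity
    obtain ⟨N, hN⟩ := hvlim (ε / ((K + 1) * t ^ (α - 1))) (div_pos hε hden)
    refine ⟨N, fun n hn => ?_⟩
    have hη : 0 < ε / ((K + 1) * t ^ (α - 1)) := div_pos hε hden
    have h1 := hK _ _ hη.le (hN n hn) t ⟨ht0, ht.2⟩
    rw [rlIntegral_one_eq, intervalIntegral.integral_sub ((hinv n).2.1.intervalIntegrable hα₀ ht)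
      (hv.intervalIntegrable hα₀ ht)] at h1
    rw [dist_eq_norm, (hinv n).2.2 t ht, add_sub_add_left_eq_sub]
    refine h1.trans_lt ?_
    calc _ < (K + 1) * (ε / ((K + 1) * t ^ (α - 1))) * t ^ (α - 1) := by gcongr; linarith
      _ = ε := by field_simp

end Regularity

/-- The trajectory is compact in U, so z also solves the equation of a cut-off, globally Lipschitz
C¹ field. -/
theorem exists_eq_integral [FiniteDimensional ℝ X] [CompleteSpace X] [ProperSpace X] (hT : 0 < T)
    (hα₀ : 0 < α) (hα₁ : α < 1) {U : Set X} (hU : IsOpen U) {f : ℝ → X → X}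
    (hf : ContDiffOn ℝ 1 (fun p : ℝ × X => f p.1 p.2) (Icc 0 T ×ˢ U)) {z : ℝ → X} {ρ : X}
    (hz : IsVolterraSolution α T f U ρ z) :
    ∃ v, PowContinuousOn α T v ∧ ∀ t ∈ Icc 0 T, z t = ρ + ∫ s in (0 : ℝ)..t, v s := by
  obtain ⟨F, V, L, -, hKV, -, hFV, -, -, -, hL', hL, hF1⟩ := exists_cutoff (T := T) hU
    hf.continuousOn (fun t ht x hx => (hasFDerivAt_slice hU (hf.differentiableOn one_ne_zero) ht
      hx).differentiableAt) (continuousOn_fderiv_slice hT hU hf)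
    (isCompact_Icc.image_of_continuousOn hz.continuousOn) (image_subset_iff.2 hz.mem)
  refine exists_eq_integral_of_lipschitz hT hα₀ hα₁ (hF1 hf) hL' hL
    ⟨hz.continuousOn, fun _ _ => mem_univ _, fun t ht => ?_⟩
  rw [hz.equation t ht]
  congr 1
  exact rlIntegral_congr ht.1 fun s hs => (hFV s _ (hKV
    (mem_image_of_mem z ⟨hs.1.le, hs.2.le.trans ht.2⟩))).symm

/-- For solutions that are primitives of functions continuous on `(0,T]` and of order `t^(α-1)`,
the equation holds with the classical formula for the Caputo derivative. -/
theorem IsCaputoSolution.classical [CompleteSpace X] (hT : 0 < T) (hα₀ : 0 < α) (hα₁ : α < 1)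
    {F : ℝ → X → X} {U : Set X} {ρ : X} {z v : ℝ → X} (hz : IsCaputoSolution α T F U ρ z)
    (hFz : ContinuousOn (fun t => F t (z t)) (Icc 0 T)) (hv : PowContinuousOn α T v)
    (hzv : ∀ t ∈ Icc 0 T, z t = ρ + ∫ s in (0 : ℝ)..t, v s) :
    ContDiffOn ℝ 1 z (Ioc 0 T) ∧ IntervalIntegrable (deriv z) volume 0 T ∧
      ∀ t ∈ Ioc 0 T,
        IntervalIntegrable (fun x => (t - x) ^ (-α) • deriv z x) volume 0 t ∧
        caputoDeriv α z t = F t (z t) := by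
  have hβ : 0 < 1 - α := by linarith
  have hder : ∀ t ∈ Ioc 0 T, HasDerivWithinAt z (v t) (Icc 0 T) t := fun t ht => by
    have ht' := Ioc_subset_Icc_self ht
    exact ((hasDerivWithinAt_integral_Icc hα₀ hv ht' (hv.continuousWithinAt ht)).const_add
      ρ).congr hzv (hzv t ht')
  have hderiv : ∀ t ∈ Ioo 0 T, deriv z t = v t := fun t ht =>
    ((hder t ⟨ht.1, ht.2.le⟩).hasDerivAt (Icc_mem_nhds ht.1 ht.2)).deriv
  -- At T the two-sided `deriv` need not be v, so agreement is used only on open intervals, which is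
  -- enough for integrals.
  have hcongr : ∀ t ∈ Ioc 0 T, ∀ x ∈ uIoo 0 t, v x = deriv z x := fun t ht x hx => by
    rw [uIoo_of_le ht.1.le] at hx
    exact (hderiv x ⟨hx.1, hx.2.trans_le ht.2⟩).symm
  refine ⟨?_, ?_, fun t ht => ⟨?_, ?_⟩⟩
  · have hu : UniqueDiffOn ℝ (Ioc 0 T) := uniqueDiffOn_Ioc 0 T
    have hder' : ∀ t ∈ Ioc 0 T, HasDerivWithinAt z (v t) (Ioc 0 T) t := fun t ht =>
      (hder t ht).mono Ioc_subset_Icc_self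
    rw [contDiffOn_one_iff_derivWithin hu]
    exact ⟨fun t ht => (hder' t ht).differentiableWithinAt,
      hv.continuousOn.congr fun t ht => (hder' t ht).derivWithin (hu t ht)⟩
  · exact (hv.intervalIntegrable hα₀ ⟨hT.le, le_rfl⟩).congr_uIoo (hcongr T ⟨hT, le_rfl⟩)
  · have h1 := intervalIntegrable_rpow_smul hβ hα₀ hv (Ioc_subset_Icc_self ht)
    rw [show 1 - α - 1 = -α by ring] at h1
    exact h1.congr_uIoo fun x hx => by simp only [hcongr t ht x hx]
  · have h1 : caputoDeriv α z t = rlIntegral (1 - α) v t := by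
      rw [caputoDeriv, rlIntegral, show 1 - α - 1 = -α by ring]
      congr 1
      exact intervalIntegral.integral_congr_uIoo fun x hx => by simp only [hcongr t ht x hx]
    rw [h1]
    -- After applying I^1: I^1 I^(1-α) v = I^(1-α) I^1 v = I^(1-α)(z - z(0)), which is the primitive
    -- of F by the Caputo equation.
    refine eqOn_of_integral_eq (by linarith) one_pos (hv.rlIntegral hβ hα₀)
      (.of_continuousOn hFz) (fun s hs => ?_) t ht
    rw [← rlIntegral_one_eq, rlIntegral_rlIntegral hβ one_pos hα₀ hv hs, add_comm 1,
      ← rlIntegral_rlIntegral one_pos hβ hα₀ hv hs]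
    have h2 : rlIntegral (1 - α) (rlIntegral 1 v) s =
        rlIntegral (1 - α) (fun x => z x - z 0) s := rlIntegral_congr hs.1 fun x hx => by
      rw [rlIntegral_one_eq, hzv x ⟨hx.1.le, hx.2.le.trans hs.2⟩, hz.initial, add_sub_cancel_left]
    have h3 := eq_add_integral_of_hasDerivAt one_pos (PowContinuousOn.of_continuousOn hFz)
      (fun x hx => (hz.equation x hx).continuousWithinAt)
      (fun x hx => (hz.equation x (Ioo_subset_Icc_self hx)).hasDerivAt (Icc_mem_nhds hx.1 hx.2)) hs
    rw [h2, h3, rlIntegral_zero_right, zero_add]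

end

/-! ### Uniqueness for C¹ fields and the coupled system for (y, Φ) -/

section

variable {X : Type*} [NormedAddCommGroup X] [NormedSpace ℝ X] {T α : ℝ}

theorem IsVolterraSolution.congr_field {F G : ℝ → X → X} {U V : Set X} {ρ : X} {z : ℝ → X}
    (h : IsVolterraSolution α T F U ρ z) (hFG : ∀ t ∈ Icc 0 T, G t (z t) = F t (z t))
    (hV : ∀ t ∈ Icc 0 T, z t ∈ V) : IsVolterraSolution α T G V ρ z := by
  refine ⟨h.continuousOn, hV, fun t ht => ?_⟩
  rw [h.equation t ht]
  congr 1
  exact rlIntegral_congr ht.1 fun s hs => (hFG s ⟨hs.1.le, hs.2.le.trans ht.2⟩).symm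

/-- Uniqueness for fields that are `C¹` in space. -/
theorem IsVolterraSolution.eqOn_of_fderiv [FiniteDimensional ℝ X] (hα₀ : 0 < α) (hα₁ : α < 1)
    {U : Set X} (hU : IsOpen U) {f : ℝ → X → X}
    (hf : ContinuousOn (fun p : ℝ × X => f p.1 p.2) (Icc 0 T ×ˢ U))
    (hfd : ∀ t ∈ Icc 0 T, ∀ x ∈ U, DifferentiableAt ℝ (f t) x)
    (hf' : ContinuousOn (fun p : ℝ × X => fderiv ℝ (f p.1) p.2) (Icc 0 T ×ˢ U))
    {ρ : X} {z₁ z₂ : ℝ → X} (h₁ : IsVolterraSolution α T f U ρ z₁)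
    (h₂ : IsVolterraSolution α T f U ρ z₂) : EqOn z₁ z₂ (Icc 0 T) := by
  -- One cutoff around the union of both trajectories supplies a Lipschitz constant valid between
  -- them, although U need not be convex.
  obtain ⟨F, V, L, -, hKV, -, hFV, -, -, -, -, hL, -⟩ := exists_cutoff hU hf hfd hf'
    ((isCompact_Icc.image_of_continuousOn h₁.continuousOn).union
      (isCompact_Icc.image_of_continuousOn h₂.continuousOn))
    (union_subset (image_subset_iff.2 h₁.mem) (image_subset_iff.2 h₂.mem))
  refine h₁.eqOn hα₀ hα₁ h₂ (continuousOn_field_comp hf h₁.continuousOn h₁.mem)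
    (continuousOn_field_comp hf h₂.continuousOn h₂.mem) (L := L) fun t ht => ?_
  rw [← hFV t _ (hKV (Or.inl (mem_image_of_mem z₁ ht))),
    ← hFV t _ (hKV (Or.inr (mem_image_of_mem z₂ ht)))]
  exact hL t ht _ _

/-- The field of the coupled system for a solution and its variation. -/
noncomputable def coupledField (f : ℝ → X → X) (t : ℝ) (p : X × (X →L[ℝ] X)) :
    X × (X →L[ℝ] X) :=
  (f t p.1, (fderiv ℝ (f t) p.1).comp p.2)

theorem contDiffOn_coupledField (hT : 0 < T) {U : Set X} (hU : IsOpen U) {f : ℝ → X → X}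
    (hf : ContDiffOn ℝ 2 (fun p : ℝ × X => f p.1 p.2) (Icc 0 T ×ˢ U)) :
    ContDiffOn ℝ 1 (fun q : ℝ × (X × (X →L[ℝ] X)) => coupledField f q.1 q.2)
      (Icc 0 T ×ˢ (U ×ˢ univ)) := by
  have hπ : ContDiffOn ℝ 1 (fun q : ℝ × (X × (X →L[ℝ] X)) => (q.1, q.2.1))
      (Icc 0 T ×ˢ (U ×ˢ univ)) := by fun_prop
  have hmaps : MapsTo (fun q : ℝ × (X × (X →L[ℝ] X)) => (q.1, q.2.1))
      (Icc 0 T ×ˢ (U ×ˢ univ)) (Icc 0 T ×ˢ U) := fun q hq => ⟨hq.1, hq.2.1⟩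
  refine ContDiffOn.prodMk ((hf.of_le one_le_two).comp hπ hmaps) ?_
  exact ((contDiffOn_fderiv_slice hT hU hf).comp hπ hmaps).clm_comp (by fun_prop)

/-- The variational field depends on t through y(t), whose derivative may blow up at 0, so it need
not be C¹ in time. Treating y as an unknown alongside Φ gives a field that is jointly C¹. -/
theorem exists_variation_eq_integral [FiniteDimensional ℝ X] (hT : 0 < T) (hα₀ : 0 < α)
    (hα₁ : α < 1) {U : Set X} (hU : IsOpen U) {f : ℝ → X → X}
    (hf : ContDiffOn ℝ 2 (fun p : ℝ × X => f p.1 p.2) (Icc 0 T ×ˢ U)) {y : ℝ → X} {ρ : X}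
    (hy : IsVolterraSolution α T f U ρ y) {Φ : ℝ → X →L[ℝ] X} {Φ₀ : X →L[ℝ] X}
    (hΦ : IsVolterraSolution α T (variationalField f y) univ Φ₀ Φ) :
    ∃ v, PowContinuousOn α T v ∧ ∀ t ∈ Icc 0 T, Φ t = Φ₀ + ∫ s in (0 : ℝ)..t, v s := by
  have : CompleteSpace X := FiniteDimensional.complete ℝ X
  have : ProperSpace (X × (X →L[ℝ] X)) := FiniteDimensional.proper ℝ _
  have hc := contDiffOn_coupledField hT hU hf
  have hpair : IsVolterraSolution α T (coupledField f) (U ×ˢ univ) (ρ, Φ₀)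
      (fun t => (y t, Φ t)) := by
    have hcont : ContinuousOn (fun t => (y t, Φ t)) (Icc 0 T) :=
      hy.continuousOn.prodMk hΦ.continuousOn
    have hmem : ∀ t ∈ Icc 0 T, (y t, Φ t) ∈ U ×ˢ (univ : Set (X →L[ℝ] X)) :=
      fun t ht => ⟨hy.mem t ht, mem_univ _⟩
    have hF := PowContinuousOn.of_continuousOn
      (continuousOn_field_comp hc.continuousOn hcont hmem)
    refine ⟨hcont, hmem, fun t ht => Prod.ext ?_ ?_⟩
    · rw [hy.equation t ht]
      exact congrArg (ρ + ·)
        ((ContinuousLinearMap.fst ℝ X (X →L[ℝ] X)).rlIntegral_comp hα₀ one_pos hF ht).symm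
    · change Φ t = _
      rw [hΦ.equation t ht]
      exact congrArg (Φ₀ + ·)
        ((ContinuousLinearMap.snd ℝ X (X →L[ℝ] X)).rlIntegral_comp hα₀ one_pos hF ht).symm
  obtain ⟨v, hv, heq⟩ := exists_eq_integral hT hα₀ hα₁ (hU.prod isOpen_univ) hc hpair
  obtain ⟨C, hC⟩ := hv.bound
  refine ⟨fun t => (v t).2, ⟨continuous_snd.comp_continuousOn hv.continuousOn, C, fun t ht =>
    (norm_snd_le _).trans (hC t ht)⟩, fun t ht => ?_⟩
  have h1 := congrArg Prod.snd (heq t ht)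
  have h2 := (ContinuousLinearMap.snd ℝ X (X →L[ℝ] X)).intervalIntegral_comp_comm
    (hv.intervalIntegrable hα₀ ht)
  exact h1.trans (congrArg (Φ₀ + ·) h2.symm)

end

/-! ### Assembly for the original field -/

theorem theorem1 (m : ℕ) (α T : ℝ) (hα₀ : 0 < α) (hα₁ : α < 1) (hT : 0 < T)
    -- the vector field, continuously differentiable in `x` on `[0,T] × U`
    (U : Set (EuclideanSpace ℝ (Fin m))) (hU : IsOpen U)
    (f : ℝ → EuclideanSpace ℝ (Fin m) → EuclideanSpace ℝ (Fin m))
    (hf : ContinuousOn (fun p : ℝ × EuclideanSpace ℝ (Fin m) => f p.1 p.2) (Icc 0 T ×ˢ U))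
    (hfd : ∀ t ∈ Icc 0 T, ∀ x ∈ U, DifferentiableAt ℝ (f t) x)
    (hf' : ContinuousOn (fun p : ℝ × EuclideanSpace ℝ (Fin m) => fderiv ℝ (f p.1) p.2)
      (Icc 0 T ×ˢ U))
    -- `y t ρ` is the solution with initial value `ρ`, whenever there is one
    (y : ℝ → EuclideanSpace ℝ (Fin m) → EuclideanSpace ℝ (Fin m))
    (hy : ∀ ρ, (∃ z, IsCaputoSolution α T f U ρ z) →
      IsCaputoSolution α T f U ρ (fun t => y t ρ))
    -- the problem with initial value `ρ₀` has a solution on `[0,T]`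
    (ρ₀ : EuclideanSpace ℝ (Fin m)) (hρ₀ : ∃ z, IsCaputoSolution α T f U ρ₀ z) :
    -- solutions are unique, and exist on `[0,T]` for all initial values near `ρ₀`
    (∀ ρ z, IsCaputoSolution α T f U ρ z → ∀ t ∈ Icc 0 T, z t = y t ρ) ∧
    (∀ᶠ ρ in 𝓝 ρ₀, ∃ z, IsCaputoSolution α T f U ρ z) ∧
    ∃ Φ : ℝ → EuclideanSpace ℝ (Fin m) →L[ℝ] EuclideanSpace ℝ (Fin m),
      -- `Φ` is the derivative of the solution with respect to the initial value
      (∀ t ∈ Icc 0 T, HasFDerivAt (fun ρ => y t ρ) (Φ t) ρ₀) ∧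
      -- `Φ` is the unique solution of the variational problem
      IsCaputoSolution α T (variationalField f (fun t => y t ρ₀)) univ
        (ContinuousLinearMap.id ℝ (EuclideanSpace ℝ (Fin m))) Φ ∧
      (∀ Ψ, IsCaputoSolution α T (variationalField f (fun t => y t ρ₀)) univ
        (ContinuousLinearMap.id ℝ (EuclideanSpace ℝ (Fin m))) Ψ → ∀ t ∈ Icc 0 T, Ψ t = Φ t) ∧
      -- `Φ` satisfies the Volterra equation, which is equivalent to the variational problem
      IsVolterraSolution α T (variationalField f (fun t => y t ρ₀)) univ
        (ContinuousLinearMap.id ℝ (EuclideanSpace ℝ (Fin m))) Φ ∧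
      (∀ Ψ, IsCaputoSolution α T (variationalField f (fun t => y t ρ₀)) univ
          (ContinuousLinearMap.id ℝ (EuclideanSpace ℝ (Fin m))) Ψ ↔
        IsVolterraSolution α T (variationalField f (fun t => y t ρ₀)) univ
          (ContinuousLinearMap.id ℝ (EuclideanSpace ℝ (Fin m))) Ψ) ∧
      -- for `f` of class `C²`, the variational equation also holds with the classical formula
      -- for the Caputo derivative
      (ContDiffOn ℝ 2 (fun p : ℝ × EuclideanSpace ℝ (Fin m) => f p.1 p.2) (Icc 0 T ×ˢ U) →
        ContDiffOn ℝ 1 Φ (Ioc 0 T) ∧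
        IntervalIntegrable (deriv Φ) MeasureTheory.volume 0 T ∧
        ∀ t ∈ Ioc 0 T,
          IntervalIntegrable (fun x => (t - x) ^ (-α) • deriv Φ x) MeasureTheory.volume 0 t ∧
          caputoDeriv α Φ t = (fderiv ℝ (f t) (y t ρ₀)).comp (Φ t)) := by
  have hiff : ∀ ρ z, IsCaputoSolution α T f U ρ z ↔ IsVolterraSolution α T f U ρ z := fun ρ z =>
    isCaputoSolution_iff_isVolterraSolution hα₀ hα₁ hT fun hc hm => continuousOn_field_comp hf hc hm
  have huniq : ∀ ρ z, IsCaputoSolution α T f U ρ z → ∀ t ∈ Icc 0 T, z t = y t ρ := fun ρ z hz =>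
    ((hiff ρ z).1 hz).eqOn_of_fderiv hα₀ hα₁ hU hf hfd hf' ((hiff ρ _).1 (hy ρ ⟨z, hz⟩))
  have hy₀ := (hiff ρ₀ _).1 (hy ρ₀ hρ₀)
  have hK := isCompact_Icc.image_of_continuousOn hy₀.continuousOn
  obtain ⟨F, V, L, hVo, hKV, hVU, hFV, hF, hFd, hF', hL', hL, -⟩ := exists_cutoff hU hf hfd hf'
    hK (image_subset_iff.2 hy₀.mem)
  have hyV : ∀ t ∈ Icc 0 T, y t ρ₀ ∈ V := fun t ht =>
    hKV (mem_image_of_mem (fun t => y t ρ₀) ht)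
  have hyF₀ : IsVolterraSolution α T F univ ρ₀ (fun t => y t ρ₀) :=
    hy₀.congr_field (fun t ht => hFV t _ (hyV t ht)) fun _ _ => mem_univ _
  have hcF : ∀ z, ContinuousOn z (Icc 0 T) → ContinuousOn (fun t => F t (z t)) (Icc 0 T) :=
    fun z hz => continuousOn_field_comp hF hz fun _ _ => mem_univ _
  obtain ⟨δ, hδ, hδV⟩ := hK.exists_thickening_subset_open hVo hKV
  obtain ⟨K, hK0, hKst⟩ := exists_volterra_stability hα₀ hα₁ T (EuclideanSpace ℝ (Fin m)) L
  -- The cut-off equation is solvable for every ρ; for ρ near ρ₀ stability keeps its solution in V,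
  -- where F = f.
  have hnear : ∀ᶠ ρ in 𝓝 ρ₀, ∃ z, IsVolterraSolution α T f U ρ z ∧ ∀ t ∈ Icc 0 T, z t ∈ V := by
    have hcont : ContinuousAt (fun ρ => K * ‖ρ - ρ₀‖) ρ₀ := by fun_prop
    filter_upwards [hcont.eventually_lt_const (by simpa using hδ)] with ρ hρ
    obtain ⟨z, hz⟩ := exists_isVolterraSolution hα₀ hα₁ hF hL ρ
    have hzV : ∀ t ∈ Icc 0 T, z t ∈ V := fun t ht => by
      refine hδV (Metric.mem_thickening_iff.2 ⟨_, mem_image_of_mem (fun t => y t ρ₀) ht, ?_⟩)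
      rw [dist_eq_norm]
      exact (hKst F _ _ _ _ _ hz hyF₀ (hcF _ hz.continuousOn) (hcF _ hyF₀.continuousOn)
        (fun s hs => hL s hs _ _) t ht).trans_lt hρ
    exact ⟨z, hz.congr_field (fun t ht => (hFV t _ (hzV t ht)).symm) fun t ht => hVU (hzV t ht),
      hzV⟩
  have hyF : ∀ᶠ ρ in 𝓝 ρ₀, IsVolterraSolution α T F univ ρ (fun t => y t ρ) := by
    filter_upwards [hnear] with ρ ⟨z, hz, hzV⟩
    have hzC := (hiff ρ z).2 hz
    refine ((hiff ρ _).1 (hy ρ ⟨z, hzC⟩)).congr_field (fun t ht => hFV t _ ?_)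
      fun _ _ => mem_univ _
    rw [← huniq ρ z hzC t ht]
    exact hzV t ht
  -- Agreement on the open set V, not just along the trajectory, is what makes the Jacobians
  -- coincide.
  have hAF : ∀ t ∈ Icc 0 T, fderiv ℝ (f t) (y t ρ₀) = fderiv ℝ (F t) (y t ρ₀) := fun t ht =>
    Filter.EventuallyEq.fderiv_eq
      (eventually_of_mem (hVo.mem_nhds (hyV t ht)) fun x hx => (hFV t x hx).symm)
  have hvar : ∀ t ∈ Icc 0 T, ∀ Ψ, variationalField f (fun t => y t ρ₀) t Ψ =
      variationalField F (fun t => y t ρ₀) t Ψ := fun t ht Ψ => by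
    simp only [variationalField, hAF t ht]
  have hvF := continuousOn_variationalField hF' hyF₀.continuousOn hyF₀.mem
  have hvf := continuousOn_variationalField hf' hy₀.continuousOn hy₀.mem
  have hvL : ∀ t ∈ Icc 0 T, ∀ Ψ₁ Ψ₂, ‖variationalField F (fun t => y t ρ₀) t Ψ₁ -
      variationalField F (fun t => y t ρ₀) t Ψ₂‖ ≤ L * ‖Ψ₁ - Ψ₂‖ := fun t ht =>
    norm_variationalField_sub_le (hL' t ht _)
  obtain ⟨Φ, hΦF⟩ := exists_isVolterraSolution hα₀ hα₁ hvF hvL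
    (ContinuousLinearMap.id ℝ (EuclideanSpace ℝ (Fin m)))
  have hΦ : IsVolterraSolution α T (variationalField f (fun t => y t ρ₀)) univ
      (ContinuousLinearMap.id ℝ (EuclideanSpace ℝ (Fin m))) Φ :=
    hΦF.congr_field (fun t ht => hvar t ht _) fun _ _ => mem_univ _
  have hviff : ∀ Ψ, IsCaputoSolution α T (variationalField f (fun t => y t ρ₀)) univ
      (ContinuousLinearMap.id ℝ (EuclideanSpace ℝ (Fin m))) Ψ ↔
      IsVolterraSolution α T (variationalField f (fun t => y t ρ₀)) univ
        (ContinuousLinearMap.id ℝ (EuclideanSpace ℝ (Fin m))) Ψ := fun Ψ =>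
    isCaputoSolution_iff_isVolterraSolution hα₀ hα₁ hT fun hc hm =>
      continuousOn_field_comp hvf hc hm
  refine ⟨huniq, hnear.mono fun ρ ⟨z, hz, _⟩ => ⟨z, (hiff ρ z).2 hz⟩, Φ,
    hasFDerivAt_volterra (z := fun ρ t => y t ρ) hα₀ hα₁ hF hFd hF' hL' hL hyF₀ hyF hΦF,
    (hviff Φ).2 hΦ, fun Ψ hΨ => ?_, hΦ, hviff, fun hf2 => ?_⟩
  · have hΨ' := (hviff Ψ).1 hΨ
    refine hΨ'.eqOn hα₀ hα₁ hΦ (continuousOn_field_comp hvf hΨ'.continuousOn hΨ'.mem)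
      (continuousOn_field_comp hvf hΦ.continuousOn hΦ.mem) (L := L) fun t ht => ?_
    rw [hvar t ht, hvar t ht]
    exact hvL t ht _ _
  · obtain ⟨v, hv, hΦv⟩ := exists_variation_eq_integral hT hα₀ hα₁ hU hf2 hy₀ hΦ
    exact ((hviff Φ).2 hΦ).classical hT hα₀ hα₁
      (continuousOn_field_comp hvf hΦ.continuousOn hΦ.mem) hv hΦv
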